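/- **Conventions.** Let $\Bbbk$ be a field. All Hopf algebras are over $\Bbbk$ and have an invertible antipode $S$; $\Delta(h)=h_{(1)}\otimes h_{(2)}$. For a Hopf algebra $H$, $H\text{-}\mathrm{Mod}$ is the monoidal category of (possibly infinite-dimensional) left $H$-modules. ${}^H_H\mathcal{YD}$ is the category of Yetter–Drinfeld modules: left $H$-modules $V$ with a left coaction $v\mapsto v^{(-1)}\otimes v^{(0)}\in H\otimes V$ such that $h_{(1)}v^{(-1)}\otimes h_{(2)}v^{(0)}=(h_{(1)}v)^{(-1)}h_{(2)}\otimes (h_{(1)}v)^{(0)}$, with tensor coaction $v\otimes w\mapsto v^{(-1)}w^{(-1)}\otimes v^{(0)}\otimes w^{(0)}$ and braiding $\Psi_{V,W}(v\otimes w)=v^{(-1)}w\otimes v^{(0)}$. An opmonoidal adjunction $L\dashv G$ consists of an oplax monoidal functor $L\colon\mathcal D\to\mathcal C$ and a strong monoidal right adjoint $G\colon\mathcal C\to\mathcal D$ whose structures correspond to each other under the adjunction. Its projection formula morphisms are $$\mathrm{lproj}_{A,X}\colon L(GA\otimes X)\xrightarrow{\mathrm{oplax}}LGA\otimes LX\xrightarrow{\mathrm{counit}\otimes\mathrm{id}}A\otimes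 LX,\qquad \mathrm{rproj}_{X,A}\colon L(X\otimes GA)\xrightarrow{\mathrm{oplax}}LX\otimes LGA\xrightarrow{\mathrm{id}\otimes\mathrm{counit}}LX\otimes A,$$ and the projection formula holds for $L$ if all of these are isomorphisms. An oplax monoidal functor $F$ between braided monoidal categories is braided if $\mathrm{oplax}_{Y,X}\circ F(\Psi_{X,Y})=\Psi_{FX,FY}\circ\mathrm{oplax}_{X,Y}$. $\mathcal Z$ denotes the Drinfeld center, with objects $(D,c)$, $c_A\colon D\otimes A\xrightarrow{\sim}A\otimes D$. **(1)** Let $L\dashv G$ be an opmonoidal adjunction such that the projection formula holds for $L$. Then $L$ induces a braided oplax monoidal functor $\mathcal Z(L)\colon\mathcal Z(\mathcal D)\to\mathcal Z(\mathcal C)$, $(D,c)\mapsto(LD,c^L)$, $f\mapsto L(f)$, where $$c^L_A=\mathrm{lproj}_{A,D}\circ L(c_{GA})\circ \mathrm{rproj}_{D,A}^{-1},$$ and whose oplax structure maps are those of $L$. **(2)** Let $\varphi\colon K\to H$ be a morphism of Hopf algebras. Let $\mathrm{Ind}_\varphi=H\otimes_K(-)\colon K\text{-}\mathrm{Mod}\to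 H\text{-}\mathrm{Mod}$, the left adjoint of the strong monoidal restriction functor $\mathrm{Res}_\varphi$, with the corresponding oplax monoidal structure. This structure is given by $h\otimes(v\otimes w)\mapsto(h_{(1)}\otimes v)\otimes(h_{(2)}\otimes w)$ and, on the unit, $h\otimes x\mapsto\varepsilon(h)x$. Then the projection formula holds for $\mathrm{Ind}_\varphi$. For every $V\in{}^K_K\mathcal{YD}$ the formula $$\delta(h\otimes v)=h_{(1)}\varphi(v^{(-1)})S(h_{(3)})\otimes h_{(2)}\otimes v^{(0)}$$ is a well-defined coaction that makes $\mathrm{Ind}_\varphi(V)$ a Yetter–Drinfeld module over $H$. The assignment $V\mapsto(\mathrm{Ind}_\varphi(V),\delta)$, $f\mapsto\mathrm{Ind}_\varphi(f)$ is a braided oplax monoidal functor ${}^K_K\mathcal{YD}\to{}^H_H\mathcal{YD}$ whose oplax structure maps are those of $\mathrm{Ind}_\varphi$. It is the functor induced on Drinfeld centers by $\mathrm{Ind}_\varphi\dashv\mathrm{Res}_\varphi$: for every $V\in{}^K_K\mathcal{YD}$ and every $H$-module $W$, the half-braiding $(h\otimes v)\otimes w\mapsto (h\otimes v)^{(-1)}w\otimes(h\otimes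 v)^{(0)}$ of $\mathrm{Ind}_\varphi(V)$ equals $\mathrm{lproj}_{W,V}\circ \mathrm{Ind}_\varphi(c_{\mathrm{Res}_\varphi W})\circ \mathrm{rproj}_{V,W}^{-1}$, where $c_U(v\otimes u)=v^{(-1)}u\otimes v^{(0)}$ for every $K$-module $U$. -/

import Mathlib

open CategoryTheory MonoidalCategory
open scoped TensorProduct

universe v₁ v₂ u₁ u₂ u

noncomputable section

namespace HopfInd

/-! ## Actions, coactions and the Yetter-Drinfeld condition -/

section Unbundled

variable {k H : Type u} [CommRing k] [Ring H]
variable {U V W V' W' : Type u} [AddCommGroup U] [Module k U] [AddCommGroup V] [Module k V]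
  [AddCommGroup W] [Module k W] [AddCommGroup V'] [Module k V'] [AddCommGroup W'] [Module k W']

section Bialgebra

variable [Bialgebra k H]

/-- The action `h (v ⊗ w) = h₁ v ⊗ h₂ w` on a tensor product. -/
def tensorAct (ρ : H →ₐ[k] Module.End k V) (σ : H →ₐ[k] Module.End k W) :
    H →ₐ[k] Module.End k (V ⊗[k] W) :=
  (Module.endTensorEndAlgHom (R := k) (S := k) (A := k) (M := V) (N := W)).comp
    ((Algebra.TensorProduct.map ρ σ).comp (Bialgebra.comulAlgHom k H))

/-- The trivial action `h x = ε(h) x` on the ground ring. -/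
def unitAct (k H : Type u) [CommRing k] [Ring H] [Bialgebra k H] : H →ₐ[k] Module.End k k :=
  (Algebra.ofId k (Module.End k k)).comp (Bialgebra.counitAlgHom k H)

/-- The orbit map `h ↦ h v`. -/
def orb (ρ : H →ₐ[k] Module.End k V) : V →ₗ[k] H →ₗ[k] V := ρ.toLinearMap.flip

@[simp]
theorem orb_apply (ρ : H →ₐ[k] Module.End k V) (v : V) (h : H) : orb ρ v h = ρ h v := rfl

theorem tensorAct_tmul (ρ : H →ₐ[k] Module.End k V) (σ : H →ₐ[k] Module.End k W)
    (h : H) (v : V) (w : W) :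
    tensorAct ρ σ h (v ⊗ₜ[k] w) =
      TensorProduct.map (orb ρ v) (orb σ w) (Coalgebra.comul (R := k) h) := by
  change Module.endTensorEndAlgHom (Algebra.TensorProduct.map ρ σ
    (Coalgebra.comul (R := k) h)) (v ⊗ₜ[k] w) = _
  induction Coalgebra.comul (R := k) h using TensorProduct.induction_on with
  | zero => simp
  | tmul a b => rfl
  | add x y hx hy => simp only [map_add, LinearMap.add_apply, hx, hy]

theorem orb_tensorAct (ρ : H →ₐ[k] Module.End k V) (σ : H →ₐ[k] Module.End k W)
    (v : V) (w : W) :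
    orb (tensorAct ρ σ) (v ⊗ₜ[k] w) =
      TensorProduct.map (orb ρ v) (orb σ w) ∘ₗ Coalgebra.comul := by
  ext h; exact tensorAct_tmul ρ σ h v w

theorem unitAct_apply (h : H) (x : k) : unitAct k H h x = Coalgebra.counit (R := k) h * x := rfl

theorem map_equivariant {ρ : H →ₐ[k] Module.End k V} {ρ' : H →ₐ[k] Module.End k V'}
    {σ : H →ₐ[k] Module.End k W} {σ' : H →ₐ[k] Module.End k W'} (f : V →ₗ[k] V') (g : W →ₗ[k] W')
    (hf : ∀ h v, f (ρ h v) = ρ' h (f v)) (hg : ∀ h w, g (σ h w) = σ' h (g w))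
    (h : H) (x : V ⊗[k] W) :
    TensorProduct.map f g (tensorAct ρ σ h x) = tensorAct ρ' σ' h (TensorProduct.map f g x) := by
  induction x using TensorProduct.induction_on with
  | zero => simp
  | add x y hx hy => simp only [map_add, hx, hy]
  | tmul v w =>
    have h1 : f ∘ₗ orb ρ v = orb ρ' (f v) := by ext a; exact hf a v
    have h2 : g ∘ₗ orb σ w = orb σ' (g w) := by ext a; exact hg a w
    rw [tensorAct_tmul, TensorProduct.map_tmul, tensorAct_tmul, ← h1, ← h2, TensorProduct.map_comp,
      LinearMap.comp_apply]

theorem assoc_equivariant (τ : H →ₐ[k] Module.End k U) (ρ : H →ₐ[k] Module.End k V)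
    (σ : H →ₐ[k] Module.End k W) (h : H) (x : (U ⊗[k] V) ⊗[k] W) :
    TensorProduct.assoc k U V W (tensorAct (tensorAct τ ρ) σ h x) =
      tensorAct τ (tensorAct ρ σ) h (TensorProduct.assoc k U V W x) := by
  refine congr($(TensorProduct.ext_threefold (g := (TensorProduct.assoc k U V W).toLinearMap ∘ₗ
    tensorAct (tensorAct τ ρ) σ h) (h := tensorAct τ (tensorAct ρ σ) h ∘ₗ
    (TensorProduct.assoc k U V W).toLinearMap) fun u v w => ?_) x)
  simp only [LinearMap.comp_apply, LinearEquiv.coe_coe, TensorProduct.assoc_tmul, tensorAct_tmul,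
    orb_tensorAct]
  have h1 : TensorProduct.map (TensorProduct.map (orb τ u) (orb ρ v) ∘ₗ Coalgebra.comul) (orb σ w)
      = TensorProduct.map (TensorProduct.map (orb τ u) (orb ρ v)) (orb σ w) ∘ₗ
        Coalgebra.comul.rTensor H := by ext; simp
  have h2 : TensorProduct.map (orb τ u) (TensorProduct.map (orb ρ v) (orb σ w) ∘ₗ Coalgebra.comul)
      = TensorProduct.map (orb τ u) (TensorProduct.map (orb ρ v) (orb σ w)) ∘ₗ
        Coalgebra.comul.lTensor H := by ext; simp
  rw [h1, h2, LinearMap.comp_apply, LinearMap.comp_apply, ← Coalgebra.coassoc_apply]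
  exact congr($(TensorProduct.map_map_comp_assoc_eq (orb τ u) (orb ρ v) (orb σ w)) _).symm

theorem lid_equivariant (ρ : H →ₐ[k] Module.End k V) (h : H) (x : k ⊗[k] V) :
    TensorProduct.lid k V (tensorAct (unitAct k H) ρ h x) = ρ h (TensorProduct.lid k V x) := by
  induction x using TensorProduct.induction_on with
  | zero => simp
  | add x y hx hy => simp only [map_add, hx, hy]
  | tmul a v =>
    rw [tensorAct_tmul]
    have : (TensorProduct.lid k V).toLinearMap ∘ₗ TensorProduct.map (orb (unitAct k H) a) (orb ρ v)
        = a • (orb ρ v ∘ₗ (TensorProduct.lid k H).toLinearMap ∘ₗ Coalgebra.counit.rTensor H) := by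
      ext b c
      simp [unitAct_apply, mul_smul]
      rw [smul_comm]
    refine congr($this (Coalgebra.comul (R := k) h)).trans ?_
    simp

theorem rid_equivariant (ρ : H →ₐ[k] Module.End k V) (h : H) (x : V ⊗[k] k) :
    TensorProduct.rid k V (tensorAct ρ (unitAct k H) h x) = ρ h (TensorProduct.rid k V x) := by
  induction x using TensorProduct.induction_on with
  | zero => simp
  | add x y hx hy => simp only [map_add, hx, hy]
  | tmul v a =>
    rw [tensorAct_tmul]
    have : (TensorProduct.rid k V).toLinearMap ∘ₗ TensorProduct.map (orb ρ v) (orb (unitAct k H) a)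
        = a • (orb ρ v ∘ₗ (TensorProduct.rid k H).toLinearMap ∘ₗ Coalgebra.counit.lTensor H) := by
      ext b c
      simp [unitAct_apply, mul_smul]
      rw [smul_comm]
    refine congr($this (Coalgebra.comul (R := k) h)).trans ?_
    simp

/-- A Yetter-Drinfeld structure on a left `H`-module: a coassociative and counital left coaction
`v ↦ v⁽⁻¹⁾ ⊗ v⁽⁰⁾` with `h₁ v⁽⁻¹⁾ ⊗ h₂ v⁽⁰⁾ = (h₁ v)⁽⁻¹⁾ h₂ ⊗ (h₁ v)⁽⁰⁾`. -/
structure IsYD (ρ : H →ₐ[k] Module.End k V) (δ : V →ₗ[k] H ⊗[k] V) : Prop where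
  coassoc (v : V) : TensorProduct.assoc k H H V (Coalgebra.comul.rTensor V (δ v)) =
    δ.lTensor H (δ v)
  counit (v : V) : TensorProduct.lid k V (Coalgebra.counit.rTensor V (δ v)) = v
  yd (h : H) (v : V) {ι : Type u} (r : Coalgebra.Repr k h ι) :
    ∑ i ∈ r.index, TensorProduct.map (LinearMap.mulLeft k (r.left i)) (ρ (r.right i)) (δ v) =
      ∑ i ∈ r.index, (LinearMap.mulRight k (r.right i)).rTensor V (δ (ρ (r.left i) v))

/-- `a ⊗ b ↦ (x ⊗ v ↦ a x ⊗ b v)`. -/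
def ydLeft (ρ : H →ₐ[k] Module.End k V) (p : H ⊗[k] V) : H ⊗[k] H →ₗ[k] H ⊗[k] V :=
  (TensorProduct.map₂ (LinearMap.mul k H) ρ.toLinearMap).flip p

@[simp]
theorem ydLeft_tmul (ρ : H →ₐ[k] Module.End k V) (p : H ⊗[k] V) (a b : H) :
    ydLeft ρ p (a ⊗ₜ b) = TensorProduct.map (LinearMap.mulLeft k a) (ρ b) p := rfl

/-- `a ⊗ b ↦ (a v)⁽⁻¹⁾ b ⊗ (a v)⁽⁰⁾`. -/
def ydRight (ρ : H →ₐ[k] Module.End k V) (δ : V →ₗ[k] H ⊗[k] V) (v : V) :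
    H ⊗[k] H →ₗ[k] H ⊗[k] V :=
  TensorProduct.lift ((LinearMap.rTensorHom V ∘ₗ (LinearMap.mul k H).flip).flip ∘ₗ δ ∘ₗ orb ρ v)

@[simp]
theorem ydRight_tmul (ρ : H →ₐ[k] Module.End k V) (δ : V →ₗ[k] H ⊗[k] V) (v : V) (a b : H) :
    ydRight ρ δ v (a ⊗ₜ b) = (LinearMap.mulRight k b).rTensor V (δ (ρ a v)) := rfl

theorem IsYD.yd' {ρ : H →ₐ[k] Module.End k V} {δ : V →ₗ[k] H ⊗[k] V} (hδ : IsYD ρ δ) (v : V) :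
    ydLeft ρ (δ v) ∘ₗ Coalgebra.comul = ydRight ρ δ v ∘ₗ Coalgebra.comul := by
  ext h
  have := hδ.yd h v (Coalgebra.Repr.arbitrary k h)
  rw [LinearMap.comp_apply, LinearMap.comp_apply, ← (Coalgebra.Repr.arbitrary k h).eq]
  simpa only [map_sum, ydLeft_tmul, ydRight_tmul] using this

theorem yd_of {ρ : H →ₐ[k] Module.End k V} {δ : V →ₗ[k] H ⊗[k] V}
    (hδ : ∀ v, ydLeft ρ (δ v) ∘ₗ Coalgebra.comul = ydRight ρ δ v ∘ₗ Coalgebra.comul)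
    (h : H) (v : V) {ι : Type u} (r : Coalgebra.Repr k h ι) :
    ∑ i ∈ r.index, TensorProduct.map (LinearMap.mulLeft k (r.left i)) (ρ (r.right i)) (δ v) =
      ∑ i ∈ r.index, (LinearMap.mulRight k (r.right i)).rTensor V (δ (ρ (r.left i) v)) := by
  have := congr($(hδ v) h)
  rw [LinearMap.comp_apply, LinearMap.comp_apply, ← r.eq] at this
  simpa only [map_sum, ydLeft_tmul, ydRight_tmul] using this

/-- `(a ⊗ v) ⊗ (b ⊗ w) ↦ a b ⊗ (v ⊗ w)`. -/
def mulTensor (k H V W : Type u) [CommRing k] [Ring H] [Bialgebra k H] [AddCommGroup V] [Module k V]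
    [AddCommGroup W] [Module k W] : (H ⊗[k] V) ⊗[k] (H ⊗[k] W) →ₗ[k] H ⊗[k] (V ⊗[k] W) :=
  (LinearMap.mul' k H).rTensor (V ⊗[k] W) ∘ₗ
    (TensorProduct.tensorTensorTensorComm k H V H W).toLinearMap

@[simp]
theorem mulTensor_tmul (a b : H) (v : V) (w : W) :
    mulTensor k H V W ((a ⊗ₜ v) ⊗ₜ (b ⊗ₜ w)) = (a * b) ⊗ₜ (v ⊗ₜ w) := rfl

/-- The codiagonal coaction `v ⊗ w ↦ v⁽⁻¹⁾ w⁽⁻¹⁾ ⊗ (v⁽⁰⁾ ⊗ w⁽⁰⁾)`. -/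
def tensorCoact (δ : V →ₗ[k] H ⊗[k] V) (γ : W →ₗ[k] H ⊗[k] W) :
    V ⊗[k] W →ₗ[k] H ⊗[k] (V ⊗[k] W) :=
  mulTensor k H V W ∘ₗ TensorProduct.map δ γ

theorem tensorCoact_tmul (δ : V →ₗ[k] H ⊗[k] V) (γ : W →ₗ[k] H ⊗[k] W) (v : V) (w : W) :
    tensorCoact δ γ (v ⊗ₜ w) = mulTensor k H V W (δ v ⊗ₜ γ w) := rfl

/-- The trivial coaction `x ↦ 1 ⊗ x` on the ground ring. -/
def unitCoact (k H : Type u) [CommRing k] [Ring H] [Bialgebra k H] : k →ₗ[k] H ⊗[k] k :=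
  TensorProduct.mk k H k 1

theorem tensor_coassoc_aux1 (p : H ⊗[k] V) (q : H ⊗[k] W) :
    TensorProduct.assoc k H H (V ⊗[k] W)
        (Coalgebra.comul.rTensor (V ⊗[k] W) (mulTensor k H V W (p ⊗ₜ q))) =
      (mulTensor k H V W).lTensor H (mulTensor k H (H ⊗[k] V) (H ⊗[k] W)
        (TensorProduct.assoc k H H V (Coalgebra.comul.rTensor V p) ⊗ₜ
          TensorProduct.assoc k H H W (Coalgebra.comul.rTensor W q))) := by
  induction p using TensorProduct.induction_on with
  | zero => simp
  | add x y hx hy => simp only [map_add, TensorProduct.add_tmul, hx, hy]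
  | tmul a v =>
    induction q using TensorProduct.induction_on with
    | zero => simp
    | add x y hx hy => simp only [map_add, TensorProduct.tmul_add, hx, hy]
    | tmul b w =>
      simp only [mulTensor_tmul, LinearMap.rTensor_tmul, Bialgebra.comul_mul]
      generalize Coalgebra.comul (R := k) a = s
      generalize Coalgebra.comul (R := k) b = t
      induction s using TensorProduct.induction_on with
      | zero => simp
      | add x y hx hy => simp only [map_add, add_mul, TensorProduct.add_tmul, hx, hy]
      | tmul a₁ a₂ =>
        induction t using TensorProduct.induction_on with
        | zero => simp
        | add x y hx hy =>
          simp only [map_add, mul_add, TensorProduct.add_tmul, TensorProduct.tmul_add, hx, hy]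
        | tmul b₁ b₂ => simp

theorem tensor_coassoc_aux2 (δ : V →ₗ[k] H ⊗[k] V) (γ : W →ₗ[k] H ⊗[k] W) (p : H ⊗[k] V)
    (q : H ⊗[k] W) :
    (tensorCoact δ γ).lTensor H (mulTensor k H V W (p ⊗ₜ q)) =
      (mulTensor k H V W).lTensor H (mulTensor k H (H ⊗[k] V) (H ⊗[k] W)
        (δ.lTensor H p ⊗ₜ γ.lTensor H q)) := by
  induction p using TensorProduct.induction_on with
  | zero => simp
  | add x y hx hy => simp only [map_add, TensorProduct.add_tmul, hx, hy]
  | tmul a v =>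
    induction q using TensorProduct.induction_on with
    | zero => simp
    | add x y hx hy => simp only [map_add, TensorProduct.tmul_add, hx, hy]
    | tmul b w => simp [tensorCoact_tmul]

theorem tensor_counit_aux (p : H ⊗[k] V) (q : H ⊗[k] W) :
    TensorProduct.lid k (V ⊗[k] W)
        (Coalgebra.counit.rTensor (V ⊗[k] W) (mulTensor k H V W (p ⊗ₜ q))) =
      TensorProduct.lid k V (Coalgebra.counit.rTensor V p) ⊗ₜ
        TensorProduct.lid k W (Coalgebra.counit.rTensor W q) := by
  induction p using TensorProduct.induction_on with
  | zero => simp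
  | add x y hx hy => simp only [map_add, TensorProduct.add_tmul, hx, hy]
  | tmul a v =>
    induction q using TensorProduct.induction_on with
    | zero => simp
    | add x y hx hy => simp only [map_add, TensorProduct.tmul_add, hx, hy]
    | tmul b w => simp [TensorProduct.smul_tmul', mul_smul, smul_comm (Coalgebra.counit (R := k) a)]

/-- `c ↦ (x ⊗ w ↦ x ⊗ c w)`. -/
def actRight (σ : H →ₐ[k] Module.End k W) (q : H ⊗[k] W) : H →ₗ[k] H ⊗[k] W :=
  (LinearMap.lTensorHom H ∘ₗ σ.toLinearMap).flip q

@[simp]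
theorem actRight_apply (σ : H →ₐ[k] Module.End k W) (q : H ⊗[k] W) (c : H) :
    actRight σ q c = (σ c).lTensor H q := rfl

theorem tensor_yd_aux1 (ρ : H →ₐ[k] Module.End k V) (σ : H →ₐ[k] Module.End k W)
    (p : H ⊗[k] V) (q : H ⊗[k] W) :
    ydLeft (tensorAct ρ σ) (mulTensor k H V W (p ⊗ₜ q)) =
      mulTensor k H V W ∘ₗ TensorProduct.map (ydLeft ρ p) (actRight σ q) ∘ₗ
        (TensorProduct.assoc k H H H).symm.toLinearMap ∘ₗ Coalgebra.comul.lTensor H := by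
  refine TensorProduct.ext' fun a b => ?_
  simp only [LinearMap.comp_apply, LinearMap.lTensor_tmul, ydLeft_tmul, LinearEquiv.coe_coe]
  induction p using TensorProduct.induction_on with
  | zero => simp [ydLeft]
  | add x y hx hy =>
    simp only [map_add, TensorProduct.add_tmul, hx, hy, ydLeft, TensorProduct.map_add_left,
      LinearMap.add_apply]
  | tmul x v =>
    induction q using TensorProduct.induction_on with
    | zero => simp [actRight]
    | add x y hx hy =>
      simp only [map_add, TensorProduct.tmul_add, hx, hy, actRight, TensorProduct.map_add_right,
        LinearMap.add_apply]
    | tmul y w =>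
      simp only [mulTensor_tmul, TensorProduct.map_tmul, tensorAct_tmul]
      induction Coalgebra.comul (R := k) b using TensorProduct.induction_on with
      | zero => simp
      | add x y hx hy => simp only [map_add, TensorProduct.tmul_add, hx, hy]
      | tmul c d => simp [mul_assoc]

theorem tensor_yd_aux2 (ρ : H →ₐ[k] Module.End k V) (σ : H →ₐ[k] Module.End k W)
    (δ : V →ₗ[k] H ⊗[k] V) (v : V) (q : H ⊗[k] W) :
    mulTensor k H V W ∘ₗ TensorProduct.map (ydRight ρ δ v) (actRight σ q) =
      mulTensor k H V W ∘ₗ TensorProduct.map (δ ∘ₗ orb ρ v) (ydLeft σ q) ∘ₗ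
        (TensorProduct.assoc k H H H).toLinearMap := by
  refine TensorProduct.ext_threefold fun a b c => ?_
  simp only [LinearMap.comp_apply, TensorProduct.map_tmul, LinearEquiv.coe_coe,
    TensorProduct.assoc_tmul, ydRight_tmul, ydLeft_tmul, orb_apply, actRight_apply]
  induction δ (ρ a v) using TensorProduct.induction_on with
  | zero => simp
  | add x y hx hy => simp only [map_add, TensorProduct.add_tmul, hx, hy]
  | tmul x v =>
    induction q using TensorProduct.induction_on with
    | zero => simp
    | add x y hx hy => simp only [map_add, TensorProduct.tmul_add, hx, hy]
    | tmul y w => simp [mul_assoc]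

theorem tensor_yd_aux3 (ρ : H →ₐ[k] Module.End k V) (σ : H →ₐ[k] Module.End k W)
    (δ : V →ₗ[k] H ⊗[k] V) (γ : W →ₗ[k] H ⊗[k] W) (v : V) (w : W) :
    mulTensor k H V W ∘ₗ TensorProduct.map (δ ∘ₗ orb ρ v) (ydRight σ γ w) ∘ₗ
        (TensorProduct.assoc k H H H).toLinearMap ∘ₗ Coalgebra.comul.rTensor H =
      ydRight (tensorAct ρ σ) (tensorCoact δ γ) (v ⊗ₜ w) := by
  refine TensorProduct.ext' fun a c => ?_
  simp only [LinearMap.comp_apply, LinearMap.rTensor_tmul, ydRight_tmul, LinearEquiv.coe_coe,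
    tensorAct_tmul]
  induction Coalgebra.comul (R := k) a using TensorProduct.induction_on with
  | zero => simp
  | add x y hx hy => simp only [map_add, TensorProduct.add_tmul, hx, hy]
  | tmul a b =>
    simp only [TensorProduct.assoc_tmul, TensorProduct.map_tmul, ydRight_tmul, tensorCoact_tmul,
      LinearMap.comp_apply, orb_apply]
    generalize δ (ρ a v) = p
    generalize γ (σ b w) = q
    induction p using TensorProduct.induction_on with
    | zero => simp
    | add x y hx hy => simp only [map_add, TensorProduct.add_tmul, hx, hy]
    | tmul x v =>
      induction q using TensorProduct.induction_on with
      | zero => simp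
      | add x y hx hy => simp only [map_add, TensorProduct.tmul_add, hx, hy]
      | tmul y w => simp [mul_assoc]

theorem IsYD.tensor {ρ : H →ₐ[k] Module.End k V} {σ : H →ₐ[k] Module.End k W}
    {δ : V →ₗ[k] H ⊗[k] V} {γ : W →ₗ[k] H ⊗[k] W} (hδ : IsYD ρ δ) (hγ : IsYD σ γ) :
    IsYD (tensorAct ρ σ) (tensorCoact δ γ) where
  coassoc x := by
    induction x using TensorProduct.induction_on with
    | zero => simp
    | add x y hx hy => simp only [map_add, hx, hy]
    | tmul v w =>
      rw [tensorCoact_tmul, tensor_coassoc_aux1, tensor_coassoc_aux2, hδ.coassoc, hγ.coassoc]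
  counit x := by
    induction x using TensorProduct.induction_on with
    | zero => simp
    | add x y hx hy => simp only [map_add, hx, hy]
    | tmul v w => rw [tensorCoact_tmul, tensor_counit_aux, hδ.counit, hγ.counit]
  yd := yd_of fun x => by
    induction x using TensorProduct.induction_on with
    | zero =>
      have : ydRight (tensorAct ρ σ) (tensorCoact δ γ) 0 = 0 := TensorProduct.ext' fun a b => by simp
      rw [this]
      ext; simp [ydLeft]
    | add x y hx hy =>
      have hL : ydLeft (tensorAct ρ σ) (tensorCoact δ γ (x + y)) =
          ydLeft (tensorAct ρ σ) (tensorCoact δ γ x) +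
            ydLeft (tensorAct ρ σ) (tensorCoact δ γ y) := by
        simp only [ydLeft, map_add]
      have hR : ydRight (tensorAct ρ σ) (tensorCoact δ γ) (x + y) =
          ydRight (tensorAct ρ σ) (tensorCoact δ γ) x +
            ydRight (tensorAct ρ σ) (tensorCoact δ γ) y := by
        refine TensorProduct.ext' fun a b => ?_
        simp
      rw [hL, hR, LinearMap.add_comp, LinearMap.add_comp, hx, hy]
    | tmul v w =>
      rw [tensorCoact_tmul, tensor_yd_aux1, ← tensor_yd_aux3]
      ext h
      have e1 := congr($(tensor_yd_aux2 ρ σ δ v (γ w))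
        (Coalgebra.comul.rTensor H (Coalgebra.comul (R := k) h)))
      have e2 : TensorProduct.map (ydLeft ρ (δ v)) (actRight σ (γ w)) ∘ₗ Coalgebra.comul.rTensor H =
          TensorProduct.map (ydRight ρ δ v) (actRight σ (γ w)) ∘ₗ Coalgebra.comul.rTensor H := by
        rw [LinearMap.map_comp_rTensor, LinearMap.map_comp_rTensor, hδ.yd']
      have e3 : TensorProduct.map (δ ∘ₗ orb ρ v) (ydLeft σ (γ w)) ∘ₗ Coalgebra.comul.lTensor H =
          TensorProduct.map (δ ∘ₗ orb ρ v) (ydRight σ γ w) ∘ₗ Coalgebra.comul.lTensor H := by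
        rw [LinearMap.map_comp_lTensor, LinearMap.map_comp_lTensor, hγ.yd']
      have e2' := congr($e2 (Coalgebra.comul (R := k) h))
      have e3' := congr($e3 (Coalgebra.comul (R := k) h))
      simp only [LinearMap.comp_apply, LinearEquiv.coe_coe] at e1 e2' e3' ⊢
      rw [← Coalgebra.coassoc_apply, LinearEquiv.symm_apply_apply, e2', e1,
        Coalgebra.coassoc_apply, e3']

theorem IsYD.unit : IsYD (unitAct k H) (unitCoact k H) where
  coassoc x := by simp [unitCoact, Algebra.TensorProduct.one_def]
  counit x := by simp [unitCoact]
  yd := yd_of fun x => by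
    have h1 : ydLeft (unitAct k H) (unitCoact k H x) =
        (TensorProduct.mk k H k).flip x ∘ₗ (TensorProduct.rid k H).toLinearMap ∘ₗ
          Coalgebra.counit.lTensor H := by
      refine TensorProduct.ext' fun a b => ?_
      simp only [unitCoact, ydLeft_tmul, TensorProduct.mk_apply, TensorProduct.map_tmul,
        LinearMap.mulLeft_apply, mul_one, unitAct_apply, LinearMap.comp_apply,
        LinearMap.lTensor_tmul, LinearEquiv.coe_coe, TensorProduct.rid_tmul, LinearMap.flip_apply]
      rw [← smul_eq_mul, TensorProduct.smul_tmul]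
    have h2 : ydRight (unitAct k H) (unitCoact k H) x =
        (TensorProduct.mk k H k).flip x ∘ₗ (TensorProduct.lid k H).toLinearMap ∘ₗ
          Coalgebra.counit.rTensor H := by
      refine TensorProduct.ext' fun a b => ?_
      simp [unitCoact, unitAct_apply, ← smul_eq_mul]
    rw [h1, h2]
    ext h
    simp

/-- The linear map `f` commutes with the coactions `δ` and `γ`. -/
def Colinear (δ : V →ₗ[k] H ⊗[k] V) (γ : W →ₗ[k] H ⊗[k] W) (f : V →ₗ[k] W) : Prop :=
  ∀ v, γ (f v) = f.lTensor H (δ v)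

theorem Colinear.map {δ : V →ₗ[k] H ⊗[k] V} {δ' : V' →ₗ[k] H ⊗[k] V'} {γ : W →ₗ[k] H ⊗[k] W}
    {γ' : W' →ₗ[k] H ⊗[k] W'} {f : V →ₗ[k] V'} {g : W →ₗ[k] W'} (hf : Colinear δ δ' f)
    (hg : Colinear γ γ' g) :
    Colinear (tensorCoact δ γ) (tensorCoact δ' γ') (TensorProduct.map f g) := by
  intro x
  induction x using TensorProduct.induction_on with
  | zero => simp
  | add x y hx hy => simp only [map_add, hx, hy]
  | tmul v w =>
    rw [TensorProduct.map_tmul, tensorCoact_tmul, tensorCoact_tmul, hf, hg]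
    generalize δ v = p
    generalize γ w = q
    induction p using TensorProduct.induction_on with
    | zero => simp
    | add x y hx hy => simp only [map_add, TensorProduct.add_tmul, hx, hy]
    | tmul x v =>
      induction q using TensorProduct.induction_on with
      | zero => simp
      | add x y hx hy => simp only [map_add, TensorProduct.tmul_add, hx, hy]
      | tmul y w => simp

theorem colinear_assoc (τ : U →ₗ[k] H ⊗[k] U) (δ : V →ₗ[k] H ⊗[k] V) (γ : W →ₗ[k] H ⊗[k] W) :
    Colinear (tensorCoact (tensorCoact τ δ) γ) (tensorCoact τ (tensorCoact δ γ))
      (TensorProduct.assoc k U V W).toLinearMap := by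
  intro x
  refine congr($(TensorProduct.ext_threefold (g := tensorCoact τ (tensorCoact δ γ) ∘ₗ
    (TensorProduct.assoc k U V W).toLinearMap) (h := (TensorProduct.assoc k U V W).toLinearMap.lTensor H
      ∘ₗ tensorCoact (tensorCoact τ δ) γ) fun u v w => ?_) x)
  simp only [LinearMap.comp_apply, LinearEquiv.coe_coe, TensorProduct.assoc_tmul, tensorCoact_tmul]
  generalize τ u = o
  generalize δ v = p
  generalize γ w = q
  induction o using TensorProduct.induction_on with
  | zero => simp
  | add x y hx hy => simp only [map_add, TensorProduct.add_tmul, hx, hy]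
  | tmul a u =>
    induction p using TensorProduct.induction_on with
    | zero => simp
    | add x y hx hy =>
      simp only [map_add, TensorProduct.add_tmul, TensorProduct.tmul_add, hx, hy]
    | tmul b v =>
      induction q using TensorProduct.induction_on with
      | zero => simp
      | add x y hx hy => simp only [map_add, TensorProduct.tmul_add, hx, hy]
      | tmul c w => simp [mul_assoc]

theorem colinear_lid (δ : V →ₗ[k] H ⊗[k] V) :
    Colinear (tensorCoact (unitCoact k H) δ) δ (TensorProduct.lid k V).toLinearMap := by
  intro x
  induction x using TensorProduct.induction_on with
  | zero => simp
  | add x y hx hy => simp only [map_add, hx, hy]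
  | tmul a v =>
    simp only [LinearEquiv.coe_coe, TensorProduct.lid_tmul, tensorCoact_tmul, map_smul]
    induction δ v using TensorProduct.induction_on with
    | zero => simp
    | add x y hx hy => simp only [map_add, TensorProduct.tmul_add, smul_add, hx, hy]
    | tmul b v => simp [unitCoact]

theorem colinear_rid (δ : V →ₗ[k] H ⊗[k] V) :
    Colinear (tensorCoact δ (unitCoact k H)) δ (TensorProduct.rid k V).toLinearMap := by
  intro x
  induction x using TensorProduct.induction_on with
  | zero => simp
  | add x y hx hy => simp only [map_add, hx, hy]
  | tmul v a =>
    simp only [LinearEquiv.coe_coe, TensorProduct.rid_tmul, tensorCoact_tmul, map_smul]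
    induction δ v using TensorProduct.induction_on with
    | zero => simp
    | add x y hx hy => simp only [map_add, TensorProduct.add_tmul, smul_add, hx, hy]
    | tmul b v => simp [unitCoact]

/-- The map `v ⊗ w ↦ v⁽⁻¹⁾ w ⊗ v⁽⁰⁾`. -/
def braidMap (δ : V →ₗ[k] H ⊗[k] V) (σ : H →ₐ[k] Module.End k W) : V ⊗[k] W →ₗ[k] W ⊗[k] V :=
  TensorProduct.lift ((LinearMap.rTensorHom V ∘ₗ orb σ).flip ∘ₗ δ)

theorem braidMap_tmul (δ : V →ₗ[k] H ⊗[k] V) (σ : H →ₐ[k] Module.End k W) (v : V) (w : W) :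
    braidMap δ σ (v ⊗ₜ w) = (orb σ w).rTensor V (δ v) := rfl

theorem braidMap_equivariant {ρ : H →ₐ[k] Module.End k V} {δ : V →ₗ[k] H ⊗[k] V} (hδ : IsYD ρ δ)
    (σ : H →ₐ[k] Module.End k W) (h : H) (x : V ⊗[k] W) :
    braidMap δ σ (tensorAct ρ σ h x) = tensorAct σ ρ h (braidMap δ σ x) := by
  induction x using TensorProduct.induction_on with
  | zero => simp
  | add x y hx hy => simp only [map_add, hx, hy]
  | tmul v w =>
    rw [tensorAct_tmul, braidMap_tmul]
    have h1 : braidMap δ σ ∘ₗ TensorProduct.map (orb ρ v) (orb σ w) =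
        (orb σ w).rTensor V ∘ₗ ydRight ρ δ v := by
      refine TensorProduct.ext' fun a b => ?_
      simp only [LinearMap.comp_apply, TensorProduct.map_tmul, braidMap_tmul, orb_apply,
        ydRight_tmul]
      induction δ (ρ a v) using TensorProduct.induction_on with
      | zero => simp
      | add x y hx hy => simp only [map_add, hx, hy]
      | tmul c v => simp
    have h2 : ∀ p : H ⊗[k] V, (orb σ w).rTensor V (ydLeft ρ p (Coalgebra.comul (R := k) h)) =
        tensorAct σ ρ h ((orb σ w).rTensor V p) := by
      intro p
      induction p using TensorProduct.induction_on with
      | zero => simp [ydLeft]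
      | add x y hx hy =>
        rw [map_add, map_add, ← hx, ← hy]
        simp only [ydLeft, map_add, LinearMap.add_apply]
      | tmul c v =>
        rw [LinearMap.rTensor_tmul, tensorAct_tmul]
        induction Coalgebra.comul (R := k) h using TensorProduct.induction_on with
        | zero => simp
        | add x y hx hy => simp only [map_add, hx, hy]
        | tmul a b => simp
    rw [← h2, ← LinearMap.comp_apply (ydLeft ρ (δ v)), hδ.yd', ← LinearMap.comp_apply, h1]
    rfl

theorem colinear_braidMap {δ : V →ₗ[k] H ⊗[k] V} {ρ : H →ₐ[k] Module.End k V} (hδ : IsYD ρ δ)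
    {γ : W →ₗ[k] H ⊗[k] W} {σ : H →ₐ[k] Module.End k W} (hγ : IsYD σ γ) :
    Colinear (tensorCoact δ γ) (tensorCoact γ δ) (braidMap δ σ) := by
  intro x
  induction x using TensorProduct.induction_on with
  | zero => simp
  | add x y hx hy => simp only [map_add, hx, hy]
  | tmul v w =>
    rw [braidMap_tmul, tensorCoact_tmul]
    have h1 : tensorCoact γ δ ∘ₗ (orb σ w).rTensor V =
        (mulTensor k H W V ∘ₗ (γ ∘ₗ orb σ w).rTensor (H ⊗[k] V)) ∘ₗ δ.lTensor H := by
      refine TensorProduct.ext' fun a v => ?_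
      simp [tensorCoact_tmul]
    have h2 : (mulTensor k H W V ∘ₗ (γ ∘ₗ orb σ w).rTensor (H ⊗[k] V)) ∘ₗ
        (TensorProduct.assoc k H H V).toLinearMap =
        (TensorProduct.assoc k H W V).toLinearMap ∘ₗ (ydRight σ γ w).rTensor V := by
      refine TensorProduct.ext_threefold fun a b v => ?_
      simp only [LinearMap.comp_apply, LinearEquiv.coe_coe, TensorProduct.assoc_tmul,
        LinearMap.rTensor_tmul, ydRight_tmul, orb_apply]
      induction γ (σ a w) using TensorProduct.induction_on with
      | zero => simp
      | add x y hx hy => simp only [map_add, TensorProduct.add_tmul, hx, hy]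
      | tmul c w => simp
    have h3 : (ydRight σ γ w).rTensor V ∘ₗ Coalgebra.comul.rTensor V =
        (ydLeft σ (γ w)).rTensor V ∘ₗ Coalgebra.comul.rTensor V := by
      rw [← LinearMap.rTensor_comp, ← LinearMap.rTensor_comp, hγ.yd']
    have h4 : ∀ q : H ⊗[k] W, TensorProduct.assoc k H W V ((ydLeft σ q).rTensor V
          ((TensorProduct.assoc k H H V).symm (δ.lTensor H (δ v)))) =
        (braidMap δ σ).lTensor H (mulTensor k H V W (δ v ⊗ₜ q)) := by
      intro q
      induction δ v using TensorProduct.induction_on with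
      | zero => simp
      | add x y hx hy => simp only [map_add, TensorProduct.add_tmul, hx, hy]
      | tmul a v =>
        induction q using TensorProduct.induction_on with
        | zero => simp [ydLeft]
        | add x y hx hy =>
          simp only [TensorProduct.tmul_add, map_add, ← hx, ← hy, ydLeft, LinearMap.rTensor_add,
            LinearMap.add_apply]
        | tmul b w =>
          simp only [LinearMap.lTensor_tmul, mulTensor_tmul, braidMap_tmul]
          induction δ v using TensorProduct.induction_on with
          | zero => simp
          | add x y hx hy => simp only [map_add, TensorProduct.tmul_add, hx, hy]
          | tmul c v => simp
    have e1 := congr($h1 (δ v))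
    have e2 := congr($h2 (Coalgebra.comul.rTensor V (δ v)))
    have e3 := congr($h3 (δ v))
    have e4 := h4 (γ w)
    rw [← hδ.coassoc, LinearEquiv.symm_apply_apply] at e4
    simp only [LinearMap.comp_apply, LinearEquiv.coe_coe] at e1 e2 e3
    rw [e1, ← hδ.coassoc, ← e4, ← e3, ← e2]

theorem braidMap_tensor_right {δ : V →ₗ[k] H ⊗[k] V} {ρ : H →ₐ[k] Module.End k V} (hδ : IsYD ρ δ)
    (σ : H →ₐ[k] Module.End k W) (τ : H →ₐ[k] Module.End k U) (v : V) (w : W) (u : U) :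
    TensorProduct.assoc k W U V (braidMap δ (tensorAct σ τ) (v ⊗ₜ (w ⊗ₜ u))) =
      (braidMap δ τ).lTensor W (TensorProduct.assoc k W V U
        ((braidMap δ σ).rTensor U ((v ⊗ₜ w) ⊗ₜ u))) := by
  rw [LinearMap.rTensor_tmul, braidMap_tmul, braidMap_tmul, orb_tensorAct, LinearMap.rTensor_comp,
    LinearMap.comp_apply]
  have h1 : (braidMap δ τ).lTensor W (TensorProduct.assoc k W V U
      ((orb σ w).rTensor V (δ v) ⊗ₜ u)) =
      TensorProduct.map (orb σ w) ((orb τ u).rTensor V) (δ.lTensor H (δ v)) := by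
    induction δ v using TensorProduct.induction_on with
    | zero => simp
    | add x y hx hy => simp only [map_add, TensorProduct.add_tmul, hx, hy]
    | tmul a v => simp [braidMap_tmul]
  rw [h1, ← hδ.coassoc]
  generalize Coalgebra.comul.rTensor V (δ v) = t
  refine congr($(TensorProduct.ext_threefold (g := (TensorProduct.assoc k W U V).toLinearMap ∘ₗ
    (TensorProduct.map (orb σ w) (orb τ u)).rTensor V) (h := TensorProduct.map (orb σ w)
      ((orb τ u).rTensor V) ∘ₗ (TensorProduct.assoc k H H V).toLinearMap) fun a b v => ?_) t)
  simp

theorem braidMap_tensor_left (δ : V →ₗ[k] H ⊗[k] V) (γ : W →ₗ[k] H ⊗[k] W)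
    (τ : H →ₐ[k] Module.End k U) (v : V) (w : W) (u : U) :
    braidMap (tensorCoact δ γ) τ ((v ⊗ₜ w) ⊗ₜ u) =
      TensorProduct.assoc k U V W ((braidMap δ τ).rTensor W ((TensorProduct.assoc k V U W).symm
        ((braidMap γ τ).lTensor V (v ⊗ₜ (w ⊗ₜ u))))) := by
  rw [LinearMap.lTensor_tmul, braidMap_tmul, braidMap_tmul, tensorCoact_tmul]
  induction γ w using TensorProduct.induction_on with
  | zero => simp
  | add x y hx hy => simp only [map_add, TensorProduct.tmul_add, hx, hy]
  | tmul b w =>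
    simp only [LinearMap.rTensor_tmul, TensorProduct.assoc_symm_tmul, braidMap_tmul]
    induction δ v using TensorProduct.induction_on with
    | zero => simp
    | add x y hx hy => simp only [map_add, TensorProduct.add_tmul, hx, hy]
    | tmul a v => simp

theorem braidMap_natural_right (δ : V →ₗ[k] H ⊗[k] V) {σ : H →ₐ[k] Module.End k W}
    {σ' : H →ₐ[k] Module.End k W'} (g : W →ₗ[k] W') (hg : ∀ h w, g (σ h w) = σ' h (g w))
    (v : V) (w : W) : braidMap δ σ' (v ⊗ₜ g w) = g.rTensor V (braidMap δ σ (v ⊗ₜ w)) := by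
  rw [braidMap_tmul, braidMap_tmul]
  induction δ v using TensorProduct.induction_on with
  | zero => simp
  | add x y hx hy => simp only [map_add, hx, hy]
  | tmul a v => simp [hg]

theorem braidMap_natural_left {δ : V →ₗ[k] H ⊗[k] V} {δ' : V' →ₗ[k] H ⊗[k] V'} {f : V →ₗ[k] V'}
    (hf : Colinear δ δ' f) (σ : H →ₐ[k] Module.End k W) (v : V) (w : W) :
    braidMap δ' σ (f v ⊗ₜ w) = f.lTensor W (braidMap δ σ (v ⊗ₜ w)) := by
  rw [braidMap_tmul, braidMap_tmul, hf v]
  induction δ v using TensorProduct.induction_on with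
  | zero => simp
  | add x y hx hy => simp only [map_add, hx, hy]
  | tmul a v => simp

end Bialgebra

section Hopf

variable (k H) in
/-- The antipode is invertible. -/
class InvertibleAntipode [HopfAlgebra k H] : Prop where
  bijective : Function.Bijective (HopfAlgebra.antipode k (A := H))

theorem counit_smul_aux [Bialgebra k H] {ρ : H →ₐ[k] Module.End k V} {δ : V →ₗ[k] H ⊗[k] V}
    (hδ : IsYD ρ δ) (σ : H →ₐ[k] Module.End k W) (v : V) (w : W) (m : H ⊗[k] H →ₗ[k] H)
    (hm : ∀ h, m (Coalgebra.comul (R := k) h) = algebraMap k H (Coalgebra.counit h)) :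
    (orb σ w ∘ₗ m).rTensor V (Coalgebra.comul.rTensor V (δ v)) = w ⊗ₜ v := by
  conv_rhs => rw [← hδ.counit v]
  induction δ v using TensorProduct.induction_on with
  | zero => simp
  | add x y hx hy => simp only [map_add, TensorProduct.tmul_add, hx, hy]
  | tmul a v => simp [hm, Algebra.algebraMap_eq_smul_one, TensorProduct.smul_tmul]

variable [HopfAlgebra k H] [InvertibleAntipode k H]

variable (k H) in
/-- The inverse of the antipode. -/
def antipodeInv : H →ₗ[k] H :=
  (LinearEquiv.ofBijective (HopfAlgebra.antipode k (A := H))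
    InvertibleAntipode.bijective).symm.toLinearMap

theorem antipode_antipodeInv (h : H) : HopfAlgebra.antipode k (antipodeInv k H h) = h :=
  (LinearEquiv.ofBijective (HopfAlgebra.antipode k (A := H))
    InvertibleAntipode.bijective).apply_symm_apply h

/-- `h₂ S⁻¹(h₁) = ε(h)`. -/
theorem antipodeInv_right (h : H) :
    LinearMap.mul' k H (TensorProduct.comm k H H ((antipodeInv k H).rTensor H
      (Coalgebra.comul (R := k) h))) = algebraMap k H (Coalgebra.counit h) := by
  apply (InvertibleAntipode.bijective (k := k) (H := H)).1
  have e : HopfAlgebra.antipode k ∘ₗ LinearMap.mul' k H ∘ₗ (TensorProduct.comm k H H).toLinearMap ∘ₗ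
      (antipodeInv k H).rTensor H =
      LinearMap.mul' k H ∘ₗ (HopfAlgebra.antipode k).lTensor H := by
    refine TensorProduct.ext' fun a b => ?_
    simp [HopfAlgebra.antipode_mul_antidistrib, antipode_antipodeInv]
  refine congr($e (Coalgebra.comul (R := k) h)).trans ?_
  simp [Algebra.algebraMap_eq_smul_one]

/-- `S⁻¹(h₂) h₁ = ε(h)`. -/
theorem antipodeInv_left (h : H) :
    LinearMap.mul' k H (TensorProduct.comm k H H ((antipodeInv k H).lTensor H
      (Coalgebra.comul (R := k) h))) = algebraMap k H (Coalgebra.counit h) := by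
  apply (InvertibleAntipode.bijective (k := k) (H := H)).1
  have e : HopfAlgebra.antipode k ∘ₗ LinearMap.mul' k H ∘ₗ (TensorProduct.comm k H H).toLinearMap ∘ₗ
      (antipodeInv k H).lTensor H =
      LinearMap.mul' k H ∘ₗ (HopfAlgebra.antipode k).rTensor H := by
    refine TensorProduct.ext' fun a b => ?_
    simp [HopfAlgebra.antipode_mul_antidistrib, antipode_antipodeInv]
  refine congr($e (Coalgebra.comul (R := k) h)).trans ?_
  simp [Algebra.algebraMap_eq_smul_one]

/-- The map `w ⊗ v ↦ v⁽⁰⁾ ⊗ S⁻¹(v⁽⁻¹⁾) w`. -/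
def braidInv (δ : V →ₗ[k] H ⊗[k] V) (σ : H →ₐ[k] Module.End k W) : W ⊗[k] V →ₗ[k] V ⊗[k] W :=
  (TensorProduct.comm k W V).toLinearMap ∘ₗ
    TensorProduct.lift ((LinearMap.rTensorHom V ∘ₗ
      LinearMap.lcomp k W (antipodeInv k H) ∘ₗ orb σ).flip ∘ₗ δ) ∘ₗ
    (TensorProduct.comm k W V).toLinearMap

theorem braidInv_tmul (δ : V →ₗ[k] H ⊗[k] V) (σ : H →ₐ[k] Module.End k W) (v : V) (w : W) :
    braidInv δ σ (w ⊗ₜ v) =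
      TensorProduct.comm k W V ((orb σ w ∘ₗ antipodeInv k H).rTensor V (δ v)) := rfl

theorem braidInv_braidMap {ρ : H →ₐ[k] Module.End k V} {δ : V →ₗ[k] H ⊗[k] V} (hδ : IsYD ρ δ)
    (σ : H →ₐ[k] Module.End k W) (x : V ⊗[k] W) : braidInv δ σ (braidMap δ σ x) = x := by
  induction x using TensorProduct.induction_on with
  | zero => simp
  | add x y hx hy => simp only [map_add, hx, hy]
  | tmul v w =>
    have h1 : braidInv δ σ (braidMap δ σ (v ⊗ₜ w)) = TensorProduct.comm k W V
        ((orb σ w ∘ₗ LinearMap.mul' k H ∘ₗ (TensorProduct.comm k H H).toLinearMap ∘ₗ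
          (antipodeInv k H).lTensor H).rTensor V
          ((TensorProduct.assoc k H H V).symm (δ.lTensor H (δ v)))) := by
      rw [braidMap_tmul]
      induction δ v using TensorProduct.induction_on with
      | zero => simp
      | add x y hx hy => simp only [map_add, hx, hy]
      | tmul a v =>
        rw [LinearMap.rTensor_tmul, LinearMap.lTensor_tmul, braidInv_tmul]
        induction δ v using TensorProduct.induction_on with
        | zero => simp
        | add x y hx hy => simp only [map_add, TensorProduct.tmul_add, hx, hy]
        | tmul b v => simp
    rw [h1, ← hδ.coassoc, LinearEquiv.symm_apply_apply,
      counit_smul_aux hδ σ v w _ (fun h => antipodeInv_left h), TensorProduct.comm_tmul]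

theorem braidMap_braidInv {ρ : H →ₐ[k] Module.End k V} {δ : V →ₗ[k] H ⊗[k] V} (hδ : IsYD ρ δ)
    (σ : H →ₐ[k] Module.End k W) (x : W ⊗[k] V) : braidMap δ σ (braidInv δ σ x) = x := by
  induction x using TensorProduct.induction_on with
  | zero => simp
  | add x y hx hy => simp only [map_add, hx, hy]
  | tmul w v =>
    have h1 : braidMap δ σ (braidInv δ σ (w ⊗ₜ v)) =
        (orb σ w ∘ₗ LinearMap.mul' k H ∘ₗ (TensorProduct.comm k H H).toLinearMap ∘ₗ
          (antipodeInv k H).rTensor H).rTensor V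
          ((TensorProduct.assoc k H H V).symm (δ.lTensor H (δ v))) := by
      rw [braidInv_tmul]
      induction δ v using TensorProduct.induction_on with
      | zero => simp
      | add x y hx hy => simp only [map_add, hx, hy]
      | tmul a v =>
        rw [LinearMap.rTensor_tmul, LinearMap.lTensor_tmul, TensorProduct.comm_tmul, braidMap_tmul]
        induction δ v using TensorProduct.induction_on with
        | zero => simp
        | add x y hx hy => simp only [map_add, TensorProduct.tmul_add, hx, hy]
        | tmul b v => simp
    rw [h1, ← hδ.coassoc, LinearEquiv.symm_apply_apply,
      counit_smul_aux hδ σ v w _ (fun h => antipodeInv_right h)]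

end Hopf
end Unbundled

/-! ## The monoidal category of left modules -/

/-- A left `H`-module, for a `k`-algebra `H`: a `k`-module with a `k`-linear action of `H`. -/
structure LMod (k H : Type u) [CommRing k] [Ring H] [Algebra k H] where
  carrier : Type u
  [grp : AddCommGroup carrier]
  [mod : Module k carrier]
  act : H →ₐ[k] Module.End k carrier

namespace LMod

section Algebra

variable {k H : Type u} [CommRing k] [Ring H] [Algebra k H]

instance : CoeSort (LMod k H) (Type u) := ⟨LMod.carrier⟩

instance (V : LMod k H) : AddCommGroup V := V.grp

instance (V : LMod k H) : Module k V := V.mod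

/-- A morphism of left `H`-modules. -/
@[ext]
structure Hom (V W : LMod k H) where
  lin : V →ₗ[k] W
  comm : ∀ (h : H) (v : V), lin (V.act h v) = W.act h (lin v)

instance : Category (LMod k H) where
  Hom := Hom
  id V := ⟨LinearMap.id, fun _ _ => rfl⟩
  comp f g := ⟨g.lin ∘ₗ f.lin, fun h v => by simp [f.comm, g.comm]⟩

@[ext]
theorem hom_ext {V W : LMod k H} {f g : V ⟶ W} (w : f.lin = g.lin) : f = g :=
  Hom.ext w

@[simp]
theorem id_lin (V : LMod k H) : Hom.lin (𝟙 V) = LinearMap.id := rfl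

@[simp]
theorem comp_lin {V W X : LMod k H} (f : V ⟶ W) (g : W ⟶ X) :
    (f ≫ g).lin = g.lin ∘ₗ f.lin := rfl

/-- A linear isomorphism that commutes with the action is an isomorphism of modules. -/
def isoMk {V W : LMod k H} (e : V ≃ₗ[k] W)
    (comm : ∀ (h : H) (v : V), e (V.act h v) = W.act h (e v)) : V ≅ W where
  hom := ⟨e.toLinearMap, comm⟩
  inv := ⟨e.symm.toLinearMap, fun h w => e.injective <| by simp [comm]⟩
  hom_inv_id := by apply hom_ext; ext v; simp
  inv_hom_id := by apply hom_ext; ext v; simp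

end Algebra

section Bialgebra

variable {k H : Type u} [CommRing k] [Ring H] [Bialgebra k H]

/-- The tensor product of two morphisms. -/
def tensorHom {V V' W W' : LMod k H} (f : V ⟶ V') (g : W ⟶ W') :
    (⟨V ⊗[k] W, tensorAct V.act W.act⟩ : LMod k H) ⟶ ⟨V' ⊗[k] W', tensorAct V'.act W'.act⟩ where
  lin := TensorProduct.map f.lin g.lin
  comm := map_equivariant f.lin g.lin f.comm g.comm

instance : MonoidalCategoryStruct (LMod k H) where
  tensorObj V W := ⟨V ⊗[k] W, tensorAct V.act W.act⟩
  tensorHom := tensorHom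
  whiskerLeft V _ _ f := tensorHom (𝟙 V) f
  whiskerRight f W := tensorHom f (𝟙 W)
  tensorUnit := ⟨k, unitAct k H⟩
  associator U V W := isoMk (TensorProduct.assoc k U V W) (assoc_equivariant U.act V.act W.act)
  leftUnitor V := isoMk (TensorProduct.lid k V) (lid_equivariant V.act)
  rightUnitor V := isoMk (TensorProduct.rid k V) (rid_equivariant V.act)

instance : MonoidalCategory (LMod k H) where
  tensorHom_def _ _ := hom_ext <| TensorProduct.ext' fun _ _ => rfl
  id_tensorHom_id _ _ := hom_ext <| TensorProduct.ext' fun _ _ => rfl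
  tensorHom_comp_tensorHom _ _ _ _ := hom_ext <| TensorProduct.ext' fun _ _ => rfl
  whiskerLeft_id _ _ := hom_ext <| TensorProduct.ext' fun _ _ => rfl
  id_whiskerRight _ _ := hom_ext <| TensorProduct.ext' fun _ _ => rfl
  associator_naturality _ _ _ := hom_ext <| TensorProduct.ext_threefold fun _ _ _ => rfl
  leftUnitor_naturality f := hom_ext <| TensorProduct.ext' fun a v => (f.lin.map_smul a v).symm
  rightUnitor_naturality f := hom_ext <| TensorProduct.ext' fun v a => (f.lin.map_smul a v).symm
  pentagon _ _ _ _ := hom_ext <| TensorProduct.ext_fourfold fun _ _ _ _ => rfl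
  triangle _ _ := hom_ext <| TensorProduct.ext_threefold fun v a w =>
    (TensorProduct.smul_tmul a v w).symm

end Bialgebra

end LMod

/-! ## The braided category of Yetter-Drinfeld modules -/

section YD

/-- A Yetter-Drinfeld structure on a left `H`-module. -/
structure YDStruct {k H : Type u} [CommRing k] [Ring H] [Bialgebra k H] (V : LMod k H) where
  coact : V →ₗ[k] H ⊗[k] V
  isYD : IsYD V.act coact

/-- A Yetter-Drinfeld module over `H`. -/
structure YD (k H : Type u) [CommRing k] [Ring H] [Bialgebra k H] where
  toLMod : LMod k H
  str : YDStruct toLMod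

variable {k H : Type u} [CommRing k] [Ring H]

section Bialgebra

variable [Bialgebra k H]

/-- The morphism of left modules `V ⊗ W ⟶ W ⊗ V`, `v ⊗ w ↦ v⁽⁻¹⁾ w ⊗ v⁽⁰⁾`. -/
def YDStruct.braid {V : LMod k H} (y : YDStruct V) (W : LMod k H) : V ⊗ W ⟶ W ⊗ V :=
  LMod.Hom.mk (V := V ⊗ W) (W := W ⊗ V) (braidMap y.coact W.act) (braidMap_equivariant y.isYD W.act)

namespace YD

/-- A morphism of Yetter-Drinfeld modules: a linear map that commutes with the actions and the
coactions. -/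
@[ext]
structure Hom (V W : YD k H) where
  hom : V.toLMod ⟶ W.toLMod
  colinear : Colinear V.str.coact W.str.coact hom.lin

instance : Category (YD k H) where
  Hom := Hom
  id V := ⟨𝟙 _, fun v => by simp⟩
  comp f g := ⟨f.hom ≫ g.hom, fun v => by
    rw [LMod.comp_lin, LinearMap.comp_apply, g.colinear, f.colinear, LinearMap.lTensor_comp,
      LinearMap.comp_apply]⟩

@[ext]
theorem hom_ext {V W : YD k H} {f g : V ⟶ W} (w : f.hom = g.hom) : f = g :=
  Hom.ext w

@[simp]
theorem id_hom (V : YD k H) : Hom.hom (𝟙 V) = 𝟙 V.toLMod := rfl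

@[simp]
theorem comp_hom {V W X : YD k H} (f : V ⟶ W) (g : W ⟶ X) : (f ≫ g).hom = f.hom ≫ g.hom := rfl

/-- A colinear isomorphism of left modules is an isomorphism of Yetter-Drinfeld modules. -/
def isoMk {V W : YD k H} (e : V.toLMod ≅ W.toLMod)
    (he : Colinear V.str.coact W.str.coact e.hom.lin) : V ≅ W where
  hom := ⟨e.hom, he⟩
  inv := ⟨e.inv, fun w => by
    have h1 : e.hom.lin ∘ₗ e.inv.lin = LinearMap.id := congr($(e.inv_hom_id).lin)
    have h2 : e.inv.lin ∘ₗ e.hom.lin = LinearMap.id := congr($(e.hom_inv_id).lin)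
    have h3 := congr(e.inv.lin.lTensor H $(he (e.inv.lin w)))
    rw [← LinearMap.lTensor_comp_apply, h2, LinearMap.lTensor_id, LinearMap.id_apply] at h3
    rw [← h3]
    exact congr(e.inv.lin.lTensor H (W.str.coact ($h1 w)))⟩
  hom_inv_id := hom_ext e.hom_inv_id
  inv_hom_id := hom_ext e.inv_hom_id

/-- The tensor product of two morphisms. -/
def tensorHom {V V' W W' : YD k H} (f : V ⟶ V') (g : W ⟶ W') :
    (⟨V.toLMod ⊗ W.toLMod, tensorCoact V.str.coact W.str.coact, V.str.isYD.tensor W.str.isYD⟩ :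
      YD k H) ⟶ ⟨V'.toLMod ⊗ W'.toLMod, tensorCoact V'.str.coact W'.str.coact,
        V'.str.isYD.tensor W'.str.isYD⟩ where
  hom := f.hom ⊗ₘ g.hom
  colinear := f.colinear.map g.colinear

instance : MonoidalCategoryStruct (YD k H) where
  tensorObj V W :=
    ⟨V.toLMod ⊗ W.toLMod, tensorCoact V.str.coact W.str.coact, V.str.isYD.tensor W.str.isYD⟩
  tensorHom := tensorHom
  whiskerLeft V _ _ f := tensorHom (𝟙 V) f
  whiskerRight f W := tensorHom f (𝟙 W)
  tensorUnit := ⟨𝟙_ (LMod k H), unitCoact k H, IsYD.unit⟩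
  associator U V W := isoMk (α_ U.toLMod V.toLMod W.toLMod)
    (colinear_assoc U.str.coact V.str.coact W.str.coact)
  leftUnitor V := isoMk (λ_ V.toLMod) (colinear_lid V.str.coact)
  rightUnitor V := isoMk (ρ_ V.toLMod) (colinear_rid V.str.coact)

instance : MonoidalCategory (YD k H) where
  tensorHom_def _ _ := hom_ext <| LMod.hom_ext <| TensorProduct.ext' fun _ _ => rfl
  id_tensorHom_id _ _ := hom_ext <| LMod.hom_ext <| TensorProduct.ext' fun _ _ => rfl
  tensorHom_comp_tensorHom _ _ _ _ :=
    hom_ext <| LMod.hom_ext <| TensorProduct.ext' fun _ _ => rfl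
  whiskerLeft_id _ _ := hom_ext <| LMod.hom_ext <| TensorProduct.ext' fun _ _ => rfl
  id_whiskerRight _ _ := hom_ext <| LMod.hom_ext <| TensorProduct.ext' fun _ _ => rfl
  associator_naturality f g h :=
    hom_ext <| associator_naturality f.hom g.hom h.hom
  leftUnitor_naturality f := hom_ext <| leftUnitor_naturality f.hom
  rightUnitor_naturality f := hom_ext <| rightUnitor_naturality f.hom
  pentagon U V W X := hom_ext <|
    MonoidalCategory.pentagon U.toLMod V.toLMod W.toLMod X.toLMod
  triangle V W := hom_ext <| MonoidalCategory.triangle V.toLMod W.toLMod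

end YD

end Bialgebra

namespace YD

variable [HopfAlgebra k H] [InvertibleAntipode k H]

/-- The braiding `v ⊗ w ↦ v⁽⁻¹⁾ w ⊗ v⁽⁰⁾`. -/
def braiding (V W : YD k H) : V ⊗ W ≅ W ⊗ V where
  hom := YD.Hom.mk (V := V ⊗ W) (W := W ⊗ V) (V.str.braid W.toLMod)
    (colinear_braidMap V.str.isYD W.str.isYD)
  inv := (isoMk (V := V ⊗ W) (W := W ⊗ V) (LMod.isoMk (V := V.toLMod ⊗ W.toLMod)
    (W := W.toLMod ⊗ V.toLMod) (LinearEquiv.ofLinearMap (braidMap V.str.coact W.toLMod.act)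
      (braidInv V.str.coact W.toLMod.act)
      (LinearMap.ext <| braidMap_braidInv V.str.isYD W.toLMod.act)
      (LinearMap.ext <| braidInv_braidMap V.str.isYD W.toLMod.act))
    (braidMap_equivariant V.str.isYD W.toLMod.act))
    (colinear_braidMap V.str.isYD W.str.isYD)).inv
  hom_inv_id := hom_ext <| LMod.hom_ext <|
    LinearMap.ext <| braidInv_braidMap V.str.isYD W.toLMod.act
  inv_hom_id := hom_ext <| LMod.hom_ext <|
    LinearMap.ext <| braidMap_braidInv V.str.isYD W.toLMod.act

instance : BraidedCategory (YD k H) where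
  braiding := braiding
  braiding_naturality_right V _ _ g := hom_ext <| LMod.hom_ext <| TensorProduct.ext' fun v w =>
    braidMap_natural_right V.str.coact g.hom.lin g.hom.comm v w
  braiding_naturality_left f W := hom_ext <| LMod.hom_ext <| TensorProduct.ext' fun v w =>
    braidMap_natural_left f.colinear W.toLMod.act v w
  hexagon_forward V W U := hom_ext <| LMod.hom_ext <| TensorProduct.ext_threefold fun v w u =>
    braidMap_tensor_right V.str.isYD W.toLMod.act U.toLMod.act v w u
  hexagon_reverse V W U := hom_ext <| LMod.hom_ext <| TensorProduct.ext_threefold' fun v w u =>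
    (TensorProduct.assoc k U.toLMod V.toLMod W.toLMod).symm_apply_eq.mpr
      (braidMap_tensor_left V.str.coact W.str.coact U.toLMod.act v w u)

end YD

end YD

/-! ## Restriction and induction along a morphism of Hopf algebras -/

section Induction

variable {k K H : Type u} [CommRing k] [Ring K] [Ring H]

section Algebra

variable [Bialgebra k K] [Bialgebra k H] (φ : K →ₐc[k] H)

/-- Restriction of modules along `φ : K → H`. -/
def resFunctor : LMod k H ⥤ LMod k K where
  obj W := ⟨W, W.act.comp (φ : K →ₐ[k] H)⟩
  map f := ⟨f.lin, fun a w => f.comm (φ a) w⟩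

/-- The relations `h φ(a) ⊗ v = h ⊗ a v` that define `H ⊗_K V` as a quotient of `H ⊗ V`. -/
def indRel (V : LMod k K) : Submodule k (H ⊗[k] V) :=
  Submodule.span k {x | ∃ (h : H) (a : K) (v : V), x = (h * φ a) ⊗ₜ v - h ⊗ₜ V.act a v}

/-- The `k`-module `H ⊗_K V`. -/
abbrev IndCarrier (V : LMod k K) : Type u := (H ⊗[k] V) ⧸ indRel φ V

variable {φ} in
/-- The element `h ⊗ v` of `H ⊗_K V`. -/
def indMk {V : LMod k K} (h : H) (v : V) : IndCarrier φ V := Submodule.Quotient.mk (h ⊗ₜ v)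

theorem indMk_mul {V : LMod k K} (h : H) (a : K) (v : V) :
    (indMk (h * φ a) v : IndCarrier φ V) = indMk h (V.act a v) :=
  (Submodule.Quotient.eq _).mpr (Submodule.subset_span ⟨h, a, v, rfl⟩)

theorem ind_ext {V : LMod k K} {X : Type u} [AddCommGroup X] [Module k X]
    {f g : IndCarrier φ V →ₗ[k] X} (w : ∀ h v, f (indMk h v) = g (indMk h v)) : f = g :=
  Submodule.linearMap_qext _ (TensorProduct.ext' w)

/-- The linear map `H ⊗_K V → X` induced by a `K`-balanced linear map `H ⊗ V → X`. -/
def indLift {V : LMod k K} {X : Type u} [AddCommGroup X] [Module k X] (f : H ⊗[k] V →ₗ[k] X)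
    (hf : ∀ h a v, f ((h * φ a) ⊗ₜ v) = f (h ⊗ₜ V.act a v)) : IndCarrier φ V →ₗ[k] X :=
  (indRel φ V).liftQ f <| Submodule.span_le.mpr <| by
    rintro _ ⟨h, a, v, rfl⟩
    simp [hf]

@[simp]
theorem indLift_mk {V : LMod k K} {X : Type u} [AddCommGroup X] [Module k X]
    (f : H ⊗[k] V →ₗ[k] X) (hf : ∀ h a v, f ((h * φ a) ⊗ₜ v) = f (h ⊗ₜ V.act a v)) (h : H) (v : V) :
    indLift φ f hf (indMk h v) = f (h ⊗ₜ v) := rfl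

/-- Left multiplication by `g` on `H ⊗_K V`. -/
def indAct (V : LMod k K) (g : H) : Module.End k (IndCarrier φ V) :=
  indLift φ ((indRel φ V).mkQ ∘ₗ (LinearMap.mulLeft k g).rTensor V) fun h a v => by
    change (indMk (g * (h * φ a)) v : IndCarrier φ V) = indMk (g * h) (V.act a v)
    rw [← mul_assoc, indMk_mul]

theorem indAct_mk (V : LMod k K) (g h : H) (v : V) :
    indAct φ V g (indMk h v) = indMk (g * h) v := rfl

/-- The left `H`-module `H ⊗_K V`, with `g (h ⊗ v) = g h ⊗ v`. -/
def indObj (V : LMod k K) : LMod k H where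
  carrier := IndCarrier φ V
  act := AlgHom.ofLinearMap
    { toFun := indAct φ V
      map_add' := fun g g' => ind_ext φ fun h v => by
        rw [LinearMap.add_apply, indAct_mk, indAct_mk, indAct_mk]
        simp only [indMk, add_mul, TensorProduct.add_tmul, Submodule.Quotient.mk_add]
      map_smul' := fun c g => ind_ext φ fun h v => by
        rw [RingHom.id_apply, LinearMap.smul_apply, indAct_mk, indAct_mk]
        simp only [indMk, smul_mul_assoc, ← TensorProduct.smul_tmul', Submodule.Quotient.mk_smul] }
    (ind_ext φ fun h v => by
      change indAct φ V 1 (indMk h v) = indMk h v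
      rw [indAct_mk, one_mul])
    (fun g g' => ind_ext φ fun h v => by
      change indAct φ V (g * g') (indMk h v) = indAct φ V g (indAct φ V g' (indMk h v))
      rw [indAct_mk, indAct_mk, indAct_mk, mul_assoc])

/-- The linear map `h ⊗ v ↦ h ⊗ f v`. -/
def indMapLin {V W : LMod k K} (f : V ⟶ W) : IndCarrier φ V →ₗ[k] IndCarrier φ W :=
  indLift φ ((indRel φ W).mkQ ∘ₗ f.lin.lTensor H) fun h a v => by
    change (indMk (h * φ a) (f.lin v) : IndCarrier φ W) = indMk h (f.lin (V.act a v))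
    rw [f.comm, indMk_mul]

theorem indMapLin_mk {V W : LMod k K} (f : V ⟶ W) (h : H) (v : V) :
    indMapLin φ f (indMk h v) = indMk h (f.lin v) := rfl

/-- The morphism of modules `h ⊗ v ↦ h ⊗ f v`. -/
def indMap {V W : LMod k K} (f : V ⟶ W) : indObj φ V ⟶ indObj φ W where
  lin := indMapLin φ f
  comm g x := congr($(ind_ext φ (f := indMapLin φ f ∘ₗ indAct φ V g)
    (g := indAct φ W g ∘ₗ indMapLin φ f) fun _ _ => rfl) x)

/-- Induction of modules along `φ : K → H`, `V ↦ H ⊗_K V`. -/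
def indFunctor : LMod k K ⥤ LMod k H where
  obj := indObj φ
  map := indMap φ
  map_id V := LMod.hom_ext <| ind_ext φ fun h v => indMapLin_mk φ (𝟙 V) h v
  map_comp f g := LMod.hom_ext <| ind_ext φ fun h v => indMapLin_mk φ (f ≫ g) h v

/-- The linear action map `H ⊗_K W → W`, `h ⊗ w ↦ h w`. -/
def indCounitLin (W : LMod k H) : IndCarrier φ ((resFunctor φ).obj W) →ₗ[k] W :=
  indLift φ (V := (resFunctor φ).obj W) (TensorProduct.lift W.act.toLinearMap) fun h a v => by
    change W.act (h * φ a) v = W.act h (W.act (φ a) v)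
    rw [map_mul]; rfl

/-- The morphism of modules `H ⊗_K W → W`, `h ⊗ w ↦ h w`. -/
def indCounit (W : LMod k H) : indObj φ ((resFunctor φ).obj W) ⟶ W where
  lin := indCounitLin φ W
  comm g x := congr($(ind_ext φ (f := indCounitLin φ W ∘ₗ indAct φ ((resFunctor φ).obj W) g)
    (g := W.act g ∘ₗ indCounitLin φ W) fun h v => by
      change W.act (g * h) v = W.act g (W.act h v)
      rw [map_mul]; rfl) x)

/-- The map `V → H ⊗_K V`, `v ↦ 1 ⊗ v`. -/
def indUnit (V : LMod k K) : V ⟶ (resFunctor φ).obj (indObj φ V) where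
  lin := (indRel φ V).mkQ ∘ₗ TensorProduct.mk k H V 1
  comm a v := by
    change indMk (1 : H) (V.act a v) = indMk (φ a * 1 : H) v
    rw [← indMk_mul, one_mul, mul_one]

/-- Induction is left adjoint to restriction. -/
def indResAdj : indFunctor φ ⊣ resFunctor φ :=
  Adjunction.mkOfUnitCounit
    { unit :=
        { app := indUnit φ
          naturality := fun _ _ _ => LMod.hom_ext <| LinearMap.ext fun _ => rfl }
      counit :=
        { app := indCounit φ
          naturality := fun _ _ f => LMod.hom_ext <| ind_ext φ fun h w => (f.comm h w).symm }
      left_triangle := by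
        ext V : 2
        refine LMod.hom_ext <| ind_ext φ fun h v => ?_
        change indMk (h * 1) v = indMk h v
        rw [mul_one]
      right_triangle := by
        ext W : 2
        refine LMod.hom_ext <| LinearMap.ext fun w => ?_
        change W.act 1 w = w
        rw [map_one]; rfl }

theorem tensorAct_comp {V W : Type u} [AddCommGroup V] [Module k V] [AddCommGroup W] [Module k W]
    (ρ : H →ₐ[k] Module.End k V) (σ : H →ₐ[k] Module.End k W) (a : K) (x : V ⊗[k] W) :
    tensorAct (ρ.comp (φ : K →ₐ[k] H)) (σ.comp (φ : K →ₐ[k] H)) a x = tensorAct ρ σ (φ a) x := by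
  induction x using TensorProduct.induction_on with
  | zero => simp
  | add x y hx hy => simp only [map_add, hx, hy]
  | tmul v w =>
    rw [tensorAct_tmul, tensorAct_tmul]
    have h1 : orb (ρ.comp (φ : K →ₐ[k] H)) v = orb ρ v ∘ₗ (φ : K →ₗ[k] H) := rfl
    have h2 : orb (σ.comp (φ : K →ₐ[k] H)) w = orb σ w ∘ₗ (φ : K →ₗ[k] H) := rfl
    rw [h1, h2, TensorProduct.map_comp, LinearMap.comp_apply]
    congr 1
    exact CoalgHomClass.map_comp_comul_apply φ a

/-- Restriction is strong monoidal, with identities as structure maps. -/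
instance : (resFunctor φ).Monoidal :=
  Functor.CoreMonoidal.toMonoidal
    { εIso := LMod.isoMk (V := 𝟙_ (LMod k K)) (W := (resFunctor φ).obj (𝟙_ (LMod k H)))
        (LinearEquiv.refl k k) fun a x => by
          change Coalgebra.counit (R := k) a * x = Coalgebra.counit (R := k) (φ a) * x
          rw [CoalgHomClass.counit_comp_apply]
      μIso := fun V W => LMod.isoMk (V := (resFunctor φ).obj V ⊗ (resFunctor φ).obj W) (W := (resFunctor φ).obj (V ⊗ W))
        (LinearEquiv.refl k (V ⊗[k] W)) (tensorAct_comp φ V.act W.act)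
      μIso_hom_natural_left := fun _ _ => LMod.hom_ext <| TensorProduct.ext' fun _ _ => rfl
      μIso_hom_natural_right := fun _ _ => LMod.hom_ext <| TensorProduct.ext' fun _ _ => rfl
      associativity := fun _ _ _ =>
        LMod.hom_ext <| TensorProduct.ext_threefold fun _ _ _ => rfl
      left_unitality := fun _ => LMod.hom_ext <| TensorProduct.ext' fun _ _ => rfl
      right_unitality := fun _ => LMod.hom_ext <| TensorProduct.ext' fun _ _ => rfl }

/-- The oplax monoidal structure of induction that corresponds to the strong monoidal structure of
restriction under the adjunction. -/
instance : (indFunctor φ).OplaxMonoidal := (indResAdj φ).leftAdjointOplaxMonoidal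

instance : (indResAdj φ).IsMonoidal := inferInstance

end Algebra

end Induction

/-! ## Projection formula, and functors induced on Drinfeld centers -/

section Center

variable {C : Type u₁} [Category.{v₁} C] [MonoidalCategory C]
  {D : Type u₂} [Category.{v₂} D] [MonoidalCategory D]

/-- An oplax monoidal functor between braided monoidal categories is braided if its structure maps
are compatible with the braidings. -/
def IsBraidedOplax [BraidedCategory C] [BraidedCategory D] (F : D ⥤ C) (O : F.OplaxMonoidal) :
    Prop :=
  ∀ X Y : D, F.map (β_ X Y).hom ≫ O.δ Y X = O.δ X Y ≫ (β_ (F.obj X) (F.obj Y)).hom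

variable {L : D ⥤ C} {G : C ⥤ D} [L.OplaxMonoidal]

/-- The left projection formula morphism `L (G A ⊗ X) ⟶ A ⊗ L X`. -/
def lproj (adj : L ⊣ G) (A : C) (X : D) : L.obj (G.obj A ⊗ X) ⟶ A ⊗ L.obj X :=
  Functor.OplaxMonoidal.δ L (G.obj A) X ≫ adj.counit.app A ▷ L.obj X

/-- The right projection formula morphism `L (X ⊗ G A) ⟶ L X ⊗ A`. -/
def rproj (adj : L ⊣ G) (X : D) (A : C) : L.obj (X ⊗ G.obj A) ⟶ L.obj X ⊗ A :=
  Functor.OplaxMonoidal.δ L X (G.obj A) ≫ L.obj X ◁ adj.counit.app A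

/-- The projection formula holds for `L`. -/
structure ProjectionFormula (adj : L ⊣ G) : Prop where
  isIso_lproj (A : C) (X : D) : IsIso (lproj adj A X)
  isIso_rproj (X : D) (A : C) : IsIso (rproj adj X A)

/-- The composite `L X ⊗ A ⟶ L (X ⊗ G A) ⟶ L (G A ⊗ X) ⟶ A ⊗ L X` of the inverse of the right
projection formula morphism, `L c`, and the left projection formula morphism. -/
def inducedBraid {adj : L ⊣ G} (hp : ProjectionFormula adj) (X : D) (A : C)
    (c : X ⊗ G.obj A ⟶ G.obj A ⊗ X) : L.obj X ⊗ A ⟶ A ⊗ L.obj X :=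
  haveI := hp.isIso_rproj X A
  inv (rproj adj X A) ≫ L.map c ≫ lproj adj A X

/-- The functor `Center D ⥤ Center C`, `(X, c) ↦ (L X, b (X, c))`, `f ↦ L f`. -/
def centerFunctor (L : D ⥤ C) (b : ∀ X : Center D, HalfBraiding (L.obj X.1))
    (hb : ∀ {X Y : Center D} (f : X ⟶ Y) (A : C),
      L.map f.f ▷ A ≫ ((b Y).β A).hom = ((b X).β A).hom ≫ A ◁ L.map f.f) :
    Center D ⥤ Center C where
  obj X := ⟨L.obj X.1, b X⟩
  map f := ⟨L.map f.f, hb f⟩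
  map_id X := Center.ext _ _ (L.map_id X.1)
  map_comp f g := Center.ext _ _ (L.map_comp f.f g.f)

end Center

/-- The functor `YD K ⥤ YD H`, `(V, δ_V) ↦ (L V, δ V)`, `f ↦ L f`. -/
def ydFunctor {k K H : Type u} [CommRing k] [Ring K] [Ring H] [Bialgebra k K] [Bialgebra k H]
    (L : LMod k K ⥤ LMod k H) (δ : ∀ V : YD k K, YDStruct (L.obj V.toLMod))
    (hδ : ∀ {V W : YD k K} (f : V ⟶ W), Colinear (δ V).coact (δ W).coact (L.map f.hom).lin) :
    YD k K ⥤ YD k H where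
  obj V := ⟨L.obj V.toLMod, δ V⟩
  map f := ⟨L.map f.hom, hδ f⟩
  map_id V := YD.hom_ext (L.map_id V.toLMod)
  map_comp f g := YD.hom_ext (L.map_comp f.hom g.hom)

end HopfInd

end

open HopfInd

noncomputable section

namespace HopfInd

/-! ### Projection morphisms of an opmonoidal adjunction -/

section Center

open Functor.LaxMonoidal Functor.OplaxMonoidal

variable {C : Type u₁} [Category.{v₁} C] [MonoidalCategory C]
  {D : Type u₂} [Category.{v₂} D] [MonoidalCategory D]
  {L : D ⥤ C} {G : C ⥤ D} [L.OplaxMonoidal]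

/-! Part (1). The induced half-braiding contains the inverse of `rproj`, but it is characterized
without it: it is the unique map `f` with `rproj ≫ f = L(c) ≫ lproj` (`inducedBraid_eq_iff`). Every
axiom is therefore checked after precomposition with the isomorphism `rproj`, where it becomes an
identity between composites of the oplax maps δ, the counit and `L(c)`. These identities follow from
naturality, from coassociativity and counitality of δ, and from monoidality of the adjunction. The
lemmas that carry them are `lproj_tensor`, `rproj_tensor` and `lproj_rproj` for the hexagon axiom,
and `rproj_comp_δ_whiskerRight`, `δ_comp_whiskerLeft_lproj` and `lproj_comp_whiskerLeft_δ` for δ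
being a morphism in the center. Braidedness (`map_β_comp_δ`) is naturality of `c` along the unit of
the adjunction, because `δ L X Y` is `rproj` precomposed with `L` of that unit.

Part (2). For induction the projection morphisms are h ⊗ (v ⊗ w) ↦ (h₁ ⊗ v) ⊗ h₂w on the right and h
⊗ (w ⊗ v) ↦ h₁w ⊗ (h₂ ⊗ v) on the left. The antipode axioms give the inverses (h ⊗ v) ⊗ w ↦ h₁ ⊗ (v
⊗ S(h₂)w) and w ⊗ (h ⊗ v) ↦ h₂ ⊗ (S⁻¹(h₁)w ⊗ v).

A half-braiding `c` on an `H`-module is the same as a Yetter-Drinfeld structure: its coaction is v ↦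
c(v ⊗ 1) on the regular module, and naturality along orbit maps recovers `c` (`halfBraiding_lin`).
So the coaction on the induced module is defined as the one of the half-braiding from part (1). Its
well-definedness, the Yetter-Drinfeld axioms, colinearity of all structure maps and braidedness are
then inherited from part (1). The explicit formula results from following (h ⊗ v) ⊗ 1 through the
composite: the inverse of `rproj` gives h₁ ⊗ (v ⊗ S(h₂)), the half-braiding of V gives h₁ ⊗
(φ(v⁽⁻¹⁾)S(h₂) ⊗ v⁽⁰⁾), and `lproj` gives h₁φ(v⁽⁻¹⁾)S(h₃) ⊗ (h₂ ⊗ v⁽⁰⁾). -/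

theorem lproj_natural_left (adj : L ⊣ G) {A B : C} (f : A ⟶ B) (X : D) :
    L.map (G.map f ▷ X) ≫ lproj adj B X = lproj adj A X ≫ f ▷ L.obj X := by
  simp [lproj, ← δ_natural_left_assoc, ← comp_whiskerRight]

theorem lproj_natural_right (adj : L ⊣ G) (A : C) {X Y : D} (f : X ⟶ Y) :
    L.map (G.obj A ◁ f) ≫ lproj adj A Y = lproj adj A X ≫ A ◁ L.map f := by
  simp [lproj, ← δ_natural_right_assoc, whisker_exchange]

theorem rproj_natural_left (adj : L ⊣ G) {X Y : D} (f : X ⟶ Y) (A : C) :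
    L.map (f ▷ G.obj A) ≫ rproj adj Y A = rproj adj X A ≫ L.map f ▷ A := by
  simp [rproj, ← δ_natural_left_assoc, whisker_exchange]

theorem rproj_natural_right (adj : L ⊣ G) (X : D) {A B : C} (f : A ⟶ B) :
    L.map (X ◁ G.map f) ≫ rproj adj X B = rproj adj X A ≫ L.obj X ◁ f := by
  simp [rproj, ← δ_natural_right_assoc, ← MonoidalCategory.whiskerLeft_comp]

/-- By naturality of δ the unit meets the counit inside the projection morphism, and the triangle
identity cancels them. The oplax maps of `L` are thus recovered from the projection morphisms, which
is what makes the induced functor braided. -/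
theorem map_whiskerRight_unit_lproj (adj : L ⊣ G) (X Y : D) :
    L.map (adj.unit.app Y ▷ X) ≫ lproj adj (L.obj Y) X = δ L Y X := by
  simp [lproj, ← δ_natural_left_assoc, ← comp_whiskerRight]

theorem map_whiskerLeft_unit_rproj (adj : L ⊣ G) (X Y : D) :
    L.map (X ◁ adj.unit.app Y) ≫ rproj adj X (L.obj Y) = δ L X Y := by
  simp [rproj, ← δ_natural_right_assoc, ← MonoidalCategory.whiskerLeft_comp]

/-- The left projection morphism for a tensor product `A ⊗ B` is iterated from those of the
factors. -/
theorem lproj_tensor [G.Monoidal] (adj : L ⊣ G) [adj.IsMonoidal] (A B : C) (X : D) :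
    L.map (μ G A B ▷ X) ≫ lproj adj (A ⊗ B) X =
      L.map (α_ _ _ _).hom ≫ lproj adj A (G.obj B ⊗ X) ≫ A ◁ lproj adj B X ≫ (α_ _ _ _).inv := by
  -- Monoidality of the adjunction splits the counit at `A ⊗ B` into δ followed by the counits at
  -- `A` and `B`; coassociativity of δ does the rest.
  have h := adj.map_μ_comp_counit_app_tensor A B
  simp only [lproj]
  rw [← δ_natural_left_assoc, ← comp_whiskerRight, h, MonoidalCategory.tensorHom_def]
  dsimp only [Functor.comp_obj, Functor.id_obj]
  simp only [comp_whiskerRight, MonoidalCategory.whiskerLeft_comp, Category.assoc]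
  rw [← whisker_exchange_assoc, δ_comp_δ_whiskerRight_assoc, δ_comp_whiskerLeft_δ_assoc]
  simp

/-- The right projection morphism for a tensor product `A ⊗ B` is iterated from those of the
factors. -/
theorem rproj_tensor [G.Monoidal] (adj : L ⊣ G) [adj.IsMonoidal] (X : D) (A B : C) :
    L.map (X ◁ μ G A B) ≫ rproj adj X (A ⊗ B) =
      L.map (α_ _ _ _).inv ≫ rproj adj (X ⊗ G.obj A) B ≫ rproj adj X A ▷ B ≫ (α_ _ _ _).hom := by
  have h := adj.map_μ_comp_counit_app_tensor A B
  simp only [rproj]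
  rw [← δ_natural_right_assoc, ← MonoidalCategory.whiskerLeft_comp, h,
    MonoidalCategory.tensorHom_def']
  dsimp only [Functor.comp_obj, Functor.id_obj]
  simp only [comp_whiskerRight, MonoidalCategory.whiskerLeft_comp, Category.assoc]
  rw [whisker_exchange_assoc, δ_comp_δ_whiskerRight_assoc, δ_comp_whiskerLeft_δ_assoc]
  simp

/-- The two projection morphisms commute with each other. -/
theorem lproj_rproj (adj : L ⊣ G) (A : C) (X : D) (B : C) :
    L.map (α_ (G.obj A) X (G.obj B)).hom ≫ lproj adj A (X ⊗ G.obj B) ≫ A ◁ rproj adj X B =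
      rproj adj (G.obj A ⊗ X) B ≫ lproj adj A X ▷ B ≫ (α_ _ _ _).hom := by
  simp only [lproj, rproj, comp_whiskerRight, Category.assoc, MonoidalCategory.whiskerLeft_comp]
  dsimp only [Functor.comp_obj, Functor.id_obj]
  rw [whisker_exchange_assoc, ← whisker_exchange_assoc, δ_comp_δ_whiskerRight_assoc]
  congr 3
  rw [← whisker_exchange]
  simp

/-- This lemma and the next two are coassociativity of δ with a counit applied to one of three
factors: the last, the first and the middle one. In the middle case the factor `G A` can be grouped
with either neighbour, which exchanges `lproj` and `rproj`. -/
theorem rproj_comp_δ_whiskerRight (adj : L ⊣ G) (X Y : D) (A : C) :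
    rproj adj (X ⊗ Y) A ≫ δ L X Y ▷ A =
      L.map (α_ _ _ _).hom ≫ δ L X (Y ⊗ G.obj A) ≫ L.obj X ◁ rproj adj Y A ≫ (α_ _ _ _).inv := by
  simp only [rproj, Category.assoc, MonoidalCategory.whiskerLeft_comp]
  rw [whisker_exchange, δ_comp_δ_whiskerRight_assoc]
  simp

theorem lproj_comp_whiskerLeft_δ (adj : L ⊣ G) (A : C) (X Y : D) :
    lproj adj A (X ⊗ Y) ≫ A ◁ δ L X Y =
      L.map (α_ _ _ _).inv ≫ δ L (G.obj A ⊗ X) Y ≫ lproj adj A X ▷ L.obj Y ≫ (α_ _ _ _).hom := by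
  simp only [lproj, Category.assoc, comp_whiskerRight]
  dsimp only [Functor.comp_obj, Functor.id_obj]
  rw [← whisker_exchange, δ_comp_whiskerLeft_δ_assoc]
  simp

theorem δ_comp_whiskerLeft_lproj (adj : L ⊣ G) (X : D) (A : C) (Y : D) :
    δ L X (G.obj A ⊗ Y) ≫ L.obj X ◁ lproj adj A Y =
      L.map (α_ _ _ _).inv ≫ δ L (X ⊗ G.obj A) Y ≫ rproj adj X A ▷ L.obj Y ≫ (α_ _ _ _).hom := by
  simp only [lproj, rproj, MonoidalCategory.whiskerLeft_comp, comp_whiskerRight]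
  rw [δ_comp_whiskerLeft_δ_assoc]
  simp

/-- Counitality of the oplax structure: on the unit object the projection morphism reduces to the
counit of the adjunction, up to unitors. -/
theorem rproj_comp_η_whiskerRight (adj : L ⊣ G) (A : C) :
    rproj adj (𝟙_ D) A ≫ η L ▷ A = L.map (λ_ _).hom ≫ adj.counit.app A ≫ (λ_ A).inv := by
  rw [← left_unitality_hom]
  simp [rproj, whisker_exchange]

theorem lproj_comp_whiskerLeft_η (adj : L ⊣ G) (A : C) :
    lproj adj A (𝟙_ D) ≫ A ◁ η L = L.map (ρ_ _).hom ≫ adj.counit.app A ≫ (ρ_ A).inv := by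
  rw [← right_unitality_hom]
  simp [lproj, ← whisker_exchange]

theorem rproj_comp_inducedBraid {adj : L ⊣ G} (hp : ProjectionFormula adj) (X : D) (A : C)
    (c : X ⊗ G.obj A ⟶ G.obj A ⊗ X) :
    rproj adj X A ≫ inducedBraid hp X A c = L.map c ≫ lproj adj A X := by
  have := hp.isIso_rproj X A
  simp [inducedBraid]

theorem inducedBraid_eq_iff {adj : L ⊣ G} (hp : ProjectionFormula adj) (X : D) (A : C)
    (c : X ⊗ G.obj A ⟶ G.obj A ⊗ X) (f : L.obj X ⊗ A ⟶ A ⊗ L.obj X) :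
    inducedBraid hp X A c = f ↔ rproj adj X A ≫ f = L.map c ≫ lproj adj A X := by
  have := hp.isIso_rproj X A
  rw [← rproj_comp_inducedBraid hp, cancel_epi, eq_comm]

/-- The half-braiding induced on `L X` by a half-braiding on `X`. -/
def inducedHalfBraiding [G.Monoidal] {adj : L ⊣ G} [adj.IsMonoidal] (hp : ProjectionFormula adj)
    {X : D} (c : HalfBraiding X) : HalfBraiding (L.obj X) where
  β A :=
    haveI := hp.isIso_rproj X A
    haveI := hp.isIso_lproj A X
    (asIso (rproj adj X A)).symm ≪≫ L.mapIso (c.β (G.obj A)) ≪≫ asIso (lproj adj A X)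
  monoidal A B := by
    change inducedBraid hp X (A ⊗ B) (c.β _).hom = _ ≫ inducedBraid hp X A (c.β _).hom ▷ B ≫ _ ≫
      A ◁ inducedBraid hp X B (c.β _).hom ≫ _
    -- Precomposing with the isomorphism `μ` of `G` replaces `G (A ⊗ B)` by `G A ⊗ G B`, so that the
    -- hexagon axiom of `c` applies and both projection morphisms split.
    rw [inducedBraid_eq_iff, ← cancel_epi (L.map (X ◁ μ G A B)), reassoc_of% @rproj_tensor,
      ← L.map_comp_assoc, c.naturality, c.monoidal]
    simp only [Functor.map_comp, Category.assoc, lproj_tensor, Iso.hom_inv_id_assoc]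
    -- The factor for `A` is resolved first; `lproj_rproj` then moves the projection of `B` next to
    -- the induced braiding for `B`, which is resolved in the same way.
    rw [← comp_whiskerRight_assoc, rproj_comp_inducedBraid, comp_whiskerRight_assoc,
      ← reassoc_of% @rproj_natural_left, ← reassoc_of% @lproj_rproj,
      ← MonoidalCategory.whiskerLeft_comp_assoc,
      rproj_comp_inducedBraid, MonoidalCategory.whiskerLeft_comp_assoc,
      ← reassoc_of% @lproj_natural_right]
    simp only [← Functor.map_comp_assoc, Iso.inv_hom_id, Category.comp_id]
  naturality {A B} f := by
    change _ ≫ inducedBraid hp X B (c.β _).hom = inducedBraid hp X A (c.β _).hom ≫ _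
    have := hp.isIso_rproj X A
    rw [← cancel_epi (rproj adj X A), ← reassoc_of% @rproj_natural_right, rproj_comp_inducedBraid,
      reassoc_of% @rproj_comp_inducedBraid, ← L.map_comp_assoc, c.naturality, L.map_comp_assoc,
      lproj_natural_left]

/-! ### The induced functor on Drinfeld centers -/

section

variable [G.Monoidal] {adj : L ⊣ G} [adj.IsMonoidal] (hp : ProjectionFormula adj)

theorem inducedHalfBraiding_β_hom {X : D} (c : HalfBraiding X) (A : C) :
    ((inducedHalfBraiding hp c).β A).hom = inducedBraid hp X A (c.β (G.obj A)).hom := rfl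

theorem inducedHalfBraiding_natural {X Y : Center D} (f : X ⟶ Y) (A : C) :
    L.map f.f ▷ A ≫ ((inducedHalfBraiding hp Y.2).β A).hom =
      ((inducedHalfBraiding hp X.2).β A).hom ≫ A ◁ L.map f.f := by
  have := hp.isIso_rproj X.1 A
  rw [← cancel_epi (rproj adj X.1 A), ← reassoc_of% @rproj_natural_left, inducedHalfBraiding_β_hom,
    inducedHalfBraiding_β_hom, rproj_comp_inducedBraid, reassoc_of% @rproj_comp_inducedBraid,
    ← L.map_comp_assoc, f.comm, L.map_comp_assoc, lproj_natural_right]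

/-- The functor that `L` induces on Drinfeld centers. -/
abbrev inducedCenterFunctor : Center D ⥤ Center C :=
  centerFunctor L (fun X => inducedHalfBraiding hp X.2) (inducedHalfBraiding_natural hp)

-- This is the condition for δ to be a morphism in the center. It is stated for arbitrary maps `c`
-- and `d`, since only naturality of δ and its coassociativity enter, no axiom of half-braidings.
-- The same lemma then serves Yetter-Drinfeld modules.
omit [G.Monoidal] [adj.IsMonoidal] in
theorem δ_whiskerRight_comp_inducedBraid {X Y : D} {A : C} (c : X ⊗ G.obj A ⟶ G.obj A ⊗ X)
    (d : Y ⊗ G.obj A ⟶ G.obj A ⊗ Y) :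
    δ L X Y ▷ A ≫ (α_ _ _ _).hom ≫ L.obj X ◁ inducedBraid hp Y A d ≫ (α_ _ _ _).inv ≫
      inducedBraid hp X A c ▷ L.obj Y ≫ (α_ _ _ _).hom =
    inducedBraid hp (X ⊗ Y) A ((α_ _ _ _).hom ≫ X ◁ d ≫ (α_ _ _ _).inv ≫ c ▷ Y ≫
      (α_ _ _ _).hom) ≫ A ◁ δ L X Y := by
  have := hp.isIso_rproj (X ⊗ Y) A
  rw [← cancel_epi (rproj adj (X ⊗ Y) A), reassoc_of% @rproj_comp_inducedBraid,
    lproj_comp_whiskerLeft_δ, reassoc_of% @rproj_comp_δ_whiskerRight, Iso.inv_hom_id_assoc,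
    ← MonoidalCategory.whiskerLeft_comp_assoc, rproj_comp_inducedBraid,
    MonoidalCategory.whiskerLeft_comp_assoc, δ_natural_right_assoc,
    reassoc_of% @δ_comp_whiskerLeft_lproj, Iso.hom_inv_id_assoc, ← comp_whiskerRight_assoc,
    rproj_comp_inducedBraid, comp_whiskerRight_assoc, δ_natural_left_assoc]
  simp

omit [G.Monoidal] [adj.IsMonoidal] in
theorem η_whiskerRight_comp_unitors (A : C) :
    η L ▷ A ≫ (λ_ A).hom ≫ (ρ_ A).inv =
      inducedBraid hp (𝟙_ D) A ((λ_ _).hom ≫ (ρ_ _).inv) ≫ A ◁ η L := by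
  have := hp.isIso_rproj (𝟙_ D) A
  rw [← cancel_epi (rproj adj (𝟙_ D) A), reassoc_of% @rproj_comp_inducedBraid,
    lproj_comp_whiskerLeft_η, reassoc_of% @rproj_comp_η_whiskerRight]
  simp

-- Write δ as `rproj` after `L` of the unit at `Y`, cancel `rproj` against the induced braiding,
-- move the unit through `c` by naturality, and reassemble δ from `lproj`.
omit [G.Monoidal] [adj.IsMonoidal] in
theorem map_β_comp_δ {X : D} (c : HalfBraiding X) (Y : D) :
    L.map (c.β Y).hom ≫ δ L Y X =
      δ L X Y ≫ inducedBraid hp X (L.obj Y) (c.β (G.obj (L.obj Y))).hom := by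
  rw [← map_whiskerLeft_unit_rproj adj X Y, Category.assoc, rproj_comp_inducedBraid,
    ← L.map_comp_assoc]
  dsimp only [Functor.comp_obj, Functor.id_obj]
  rw [c.naturality, L.map_comp_assoc]
  exact congrArg (L.map (c.β Y).hom ≫ ·) (map_whiskerRight_unit_lproj adj X Y).symm

/-- The oplax structure maps of `L` are morphisms in the Drinfeld center. -/
def inducedCenterδ (X Y : Center D) : (inducedCenterFunctor hp).obj (X ⊗ Y) ⟶
    (inducedCenterFunctor hp).obj X ⊗ (inducedCenterFunctor hp).obj Y where
  f := δ L X.1 Y.1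
  comm A := δ_whiskerRight_comp_inducedBraid hp (X.2.β (G.obj A)).hom (Y.2.β (G.obj A)).hom

/-- The oplax unit map of `L` is a morphism in the Drinfeld center. -/
def inducedCenterη : (inducedCenterFunctor hp).obj (𝟙_ (Center D)) ⟶ 𝟙_ (Center C) where
  f := η L
  comm A := η_whiskerRight_comp_unitors hp A

/-- The oplax monoidal structure on the functor that `L` induces on Drinfeld centers. -/
@[reducible]
def inducedCenterOplax : (inducedCenterFunctor hp).OplaxMonoidal where
  η := inducedCenterη hp
  δ := inducedCenterδ hp
  δ_natural_left f Y := Center.ext _ _ (δ_natural_left L f.f Y.1)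
  δ_natural_right X f := Center.ext _ _ (δ_natural_right L X.1 f.f)
  oplax_associativity X Y Z := Center.ext _ _ (oplax_associativity L X.1 Y.1 Z.1)
  oplax_left_unitality X := Center.ext _ _ <| by
    rw [Center.leftUnitor_inv_f]
    refine (oplax_left_unitality L X.1).trans ?_
    rw [← Center.leftUnitor_inv_f]
    rfl
  oplax_right_unitality X := Center.ext _ _ <| by
    rw [Center.rightUnitor_inv_f]
    refine (oplax_right_unitality L X.1).trans ?_
    rw [← Center.rightUnitor_inv_f]
    rfl

theorem isBraidedOplax_inducedCenterFunctor :
    IsBraidedOplax (inducedCenterFunctor hp) (inducedCenterOplax hp) :=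
  fun X Y => Center.ext _ _ (map_β_comp_δ hp X.2 Y.1)

end

end Center

/-! ### Collapsing Sweedler sums -/

section Sweedler

variable {k A X P : Type u} [CommRing k] [AddCommGroup A] [Module k A] [Coalgebra k A]
  [AddCommGroup X] [Module k X] [AddCommGroup P] [Module k P]

/-- If `m (a₁ ⊗ a₂) = ε(a) x` and `D (a ⊗ b) = B a₁ (m (a₂ ⊗ b))`, then `D (a₁ ⊗ a₂) = B a x`. -/
theorem comul_eq_of_coassoc_right {m : A ⊗[k] A →ₗ[k] X} {x : X}
    (hm : ∀ a, m (Coalgebra.comul (R := k) a) = Coalgebra.counit (R := k) a • x)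
    (B : A →ₗ[k] X →ₗ[k] P) (D : A ⊗[k] A →ₗ[k] P)
    (hD : ∀ a b, D (a ⊗ₜ b) = TensorProduct.lift B (m.lTensor A
      (TensorProduct.assoc k A A A (Coalgebra.comul (R := k) a ⊗ₜ b)))) (a : A) :
    D (Coalgebra.comul (R := k) a) = B a x := by
  have h1 : D = TensorProduct.lift B ∘ₗ m.lTensor A ∘ₗ
      (TensorProduct.assoc k A A A).toLinearMap ∘ₗ Coalgebra.comul.rTensor A :=
    TensorProduct.ext' hD
  have h2 : TensorProduct.lift B ∘ₗ (m ∘ₗ Coalgebra.comul).lTensor A =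
      B.flip x ∘ₗ (TensorProduct.rid k A).toLinearMap ∘ₗ Coalgebra.counit.lTensor A :=
    TensorProduct.ext' fun a b => by simp [hm]
  rw [h1]
  simp only [LinearMap.comp_apply, LinearEquiv.coe_coe, Coalgebra.coassoc_apply]
  rw [← LinearMap.lTensor_comp_apply]
  refine congr($h2 (Coalgebra.comul (R := k) a)).trans ?_
  simp

/-- If `m (a₁ ⊗ a₂) = ε(a) x` and `D (a ⊗ b) = B (m (a ⊗ b₁)) b₂`, then `D (a₁ ⊗ a₂) = B x a`. -/
theorem comul_eq_of_coassoc_left {m : A ⊗[k] A →ₗ[k] X} {x : X}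
    (hm : ∀ a, m (Coalgebra.comul (R := k) a) = Coalgebra.counit (R := k) a • x)
    (B : X →ₗ[k] A →ₗ[k] P) (D : A ⊗[k] A →ₗ[k] P)
    (hD : ∀ a b, D (a ⊗ₜ b) = TensorProduct.lift B (m.rTensor A
      ((TensorProduct.assoc k A A A).symm (a ⊗ₜ Coalgebra.comul (R := k) b)))) (a : A) :
    D (Coalgebra.comul (R := k) a) = B x a := by
  have h1 : D = TensorProduct.lift B ∘ₗ m.rTensor A ∘ₗ
      (TensorProduct.assoc k A A A).symm.toLinearMap ∘ₗ Coalgebra.comul.lTensor A :=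
    TensorProduct.ext' hD
  have h2 : TensorProduct.lift B ∘ₗ (m ∘ₗ Coalgebra.comul).rTensor A =
      B x ∘ₗ (TensorProduct.lid k A).toLinearMap ∘ₗ Coalgebra.counit.rTensor A :=
    TensorProduct.ext' fun a b => by simp [hm]
  rw [h1]
  simp only [LinearMap.comp_apply, LinearEquiv.coe_coe, Coalgebra.coassoc_symm_apply]
  rw [← LinearMap.rTensor_comp_apply]
  refine congr($h2 (Coalgebra.comul (R := k) a)).trans ?_
  simp

end Sweedler

/-! ### Antipode identities -/

section Antipode

variable {k H : Type u} [CommRing k] [Ring H] [HopfAlgebra k H]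

/-- The four identities S(h₁)h₂, h₁S(h₂), S⁻¹(h₂)h₁, h₂S⁻¹(h₁) = ε(h), in the form of the hypothesis
`hm` of the collapsing lemmas with `x = 1`. -/
theorem antipode_left_smul (h : H) :
    (LinearMap.mul' k H ∘ₗ (HopfAlgebra.antipode k).rTensor H) (Coalgebra.comul (R := k) h) =
      Coalgebra.counit (R := k) h • 1 := by
  simp [Algebra.algebraMap_eq_smul_one]

theorem antipode_right_smul (h : H) :
    (LinearMap.mul' k H ∘ₗ (HopfAlgebra.antipode k).lTensor H) (Coalgebra.comul (R := k) h) =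
      Coalgebra.counit (R := k) h • 1 := by
  simp [Algebra.algebraMap_eq_smul_one]

variable [InvertibleAntipode k H]

theorem antipodeInv_left_smul (h : H) :
    (LinearMap.mul' k H ∘ₗ (TensorProduct.comm k H H).toLinearMap ∘ₗ (antipodeInv k H).lTensor H)
      (Coalgebra.comul (R := k) h) = Coalgebra.counit (R := k) h • 1 :=
  (antipodeInv_left h).trans (Algebra.algebraMap_eq_smul_one _)

theorem antipodeInv_right_smul (h : H) :
    (LinearMap.mul' k H ∘ₗ (TensorProduct.comm k H H).toLinearMap ∘ₗ (antipodeInv k H).rTensor H)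
      (Coalgebra.comul (R := k) h) = Coalgebra.counit (R := k) h • 1 :=
  (antipodeInv_right h).trans (Algebra.algebraMap_eq_smul_one _)

theorem antipodeInv_mul (g h : H) :
    antipodeInv k H (g * h) = antipodeInv k H h * antipodeInv k H g := by
  apply (InvertibleAntipode.bijective (k := k) (H := H)).1
  rw [HopfAlgebra.antipode_mul_antidistrib]
  simp only [antipode_antipodeInv]

end Antipode

/-! ### Explicit structure maps of induction -/

section Induction

variable {k K H : Type u} [CommRing k] [Ring K] [Ring H]

section Bialgebra

variable [Bialgebra k K] [Bialgebra k H] (φ : K →ₐc[k] H)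

/-- The bilinear map `(h, v) ↦ h ⊗ v` into `H ⊗_K V`. -/
def indMkBil (V : LMod k K) : H →ₗ[k] V →ₗ[k] IndCarrier φ V :=
  TensorProduct.curry (indRel φ V).mkQ

theorem orb_indObj (V : LMod k K) (v : V) :
    orb (indObj φ V).act (indMk 1 v : IndCarrier φ V) = (indMkBil φ V).flip v := by
  ext h
  change (indMk (h * 1) v : IndCarrier φ V) = indMk h v
  rw [mul_one]

/-- The oplax map is the mate of the strong monoidal structure of restriction, so it sends h ⊗ (v ⊗
w) to the action of h on (1 ⊗ v) ⊗ (1 ⊗ w). -/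
theorem ind_δ_lin_mk (V W : LMod k K) (h : H) (v : V) (w : W) :
    (Functor.OplaxMonoidal.δ (indFunctor φ) V W).lin
      (indMk h (v ⊗ₜ[k] w) : IndCarrier φ (V ⊗ W)) =
    TensorProduct.map ((indMkBil φ V).flip v) ((indMkBil φ W).flip w)
      (Coalgebra.comul (R := k) h) := by
  rw [← orb_indObj, ← orb_indObj]
  exact tensorAct_tmul (indObj φ V).act (indObj φ W).act h (indMk 1 v) (indMk 1 w)

theorem ind_η_lin_mk (h : H) (x : k) :
    (Functor.OplaxMonoidal.η (indFunctor φ)).lin (indMk h x : IndCarrier φ (𝟙_ (LMod k K))) =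
      (Coalgebra.counit (R := k) h * x : k) :=
  rfl

/-- The counit is the action map, so it turns the second factor h₂ ⊗ w of δ into h₂w. -/
theorem rproj_lin_mk (V : LMod k K) (W : LMod k H) (h : H) (v : V) (w : W) :
    (rproj (indResAdj φ) V W).lin
      (indMk h (v ⊗ₜ[k] w) : IndCarrier φ (V ⊗ (resFunctor φ).obj W)) =
    TensorProduct.map ((indMkBil φ V).flip v) (orb W.act w) (Coalgebra.comul (R := k) h) := by
  have h1 := congr($(TensorProduct.map_comp LinearMap.id (indCounitLin φ W)
    ((indMkBil φ V).flip v) ((indMkBil φ ((resFunctor φ).obj W)).flip w))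
    (Coalgebra.comul (R := k) h))
  have h2 : indCounitLin φ W ∘ₗ (indMkBil φ ((resFunctor φ).obj W)).flip w = orb W.act w := rfl
  rw [h2, LinearMap.id_comp] at h1
  exact (congrArg (TensorProduct.map LinearMap.id (indCounitLin φ W))
    (ind_δ_lin_mk φ V ((resFunctor φ).obj W) h v w)).trans h1.symm

theorem lproj_lin_mk (V : LMod k K) (W : LMod k H) (h : H) (w : W) (v : V) :
    (lproj (indResAdj φ) W V).lin
      (indMk h (w ⊗ₜ[k] v) : IndCarrier φ ((resFunctor φ).obj W ⊗ V)) =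
    TensorProduct.map (orb W.act w) ((indMkBil φ V).flip v) (Coalgebra.comul (R := k) h) := by
  have h1 := congr($(TensorProduct.map_comp (indCounitLin φ W) LinearMap.id
    ((indMkBil φ ((resFunctor φ).obj W)).flip w) ((indMkBil φ V).flip v))
    (Coalgebra.comul (R := k) h))
  have h2 : indCounitLin φ W ∘ₗ (indMkBil φ ((resFunctor φ).obj W)).flip w = orb W.act w := rfl
  rw [h2, LinearMap.id_comp] at h1
  exact (congrArg (TensorProduct.map (indCounitLin φ W) LinearMap.id)
    (ind_δ_lin_mk φ ((resFunctor φ).obj W) V h w v)).trans h1.symm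

theorem comul_mul_map (h : H) (a : K) :
    Coalgebra.comul (R := k) (h * φ a) = Coalgebra.comul (R := k) h *
      TensorProduct.map (φ : K →ₗ[k] H) (φ : K →ₗ[k] H) (Coalgebra.comul (R := k) a) := by
  rw [Bialgebra.comul_mul]
  congr 1
  exact (CoalgHomClass.map_comp_comul_apply φ a).symm

end Bialgebra

end Induction

/-! ### Inverting the projection morphisms by Sweedler calculus -/

section ProjectionInverse

variable {k K H : Type u} [CommRing k] [Ring K] [Ring H] [Bialgebra k K] [HopfAlgebra k H]
  (φ : K →ₐc[k] H) {V W P Q : Type u} [AddCommGroup V] [Module k V]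
  [AddCommGroup W] [Module k W] [AddCommGroup P] [Module k P] [AddCommGroup Q] [Module k Q]
  (ρ : K →ₐ[k] Module.End k V) (σ : H →ₐ[k] Module.End k W)

/-- The map `a ⊗ b ↦ (v ⊗ w ↦ a ⊗ (v ⊗ S(b) w))`. -/
def rprojInvAux (I : H →ₗ[k] V ⊗[k] W →ₗ[k] P) : H ⊗[k] H →ₗ[k] V ⊗[k] W →ₗ[k] P :=
  TensorProduct.lift <| (LinearMap.llcomp k (V ⊗[k] W) (V ⊗[k] W) P ∘ₗ I).compl₂
    (LinearMap.lTensorHom V ∘ₗ σ.toLinearMap ∘ₗ HopfAlgebra.antipode k)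

@[simp]
theorem rprojInvAux_tmul (I : H →ₗ[k] V ⊗[k] W →ₗ[k] P) (a b : H) (v : V) (w : W) :
    rprojInvAux σ I (a ⊗ₜ b) (v ⊗ₜ w) = I a (v ⊗ₜ[k] σ (HopfAlgebra.antipode k b) w) := rfl

theorem antipode_right_smul_map (a : K) :
    (LinearMap.mul' k H ∘ₗ (HopfAlgebra.antipode k).lTensor H ∘ₗ
      TensorProduct.map (φ : K →ₗ[k] H) (φ : K →ₗ[k] H)) (Coalgebra.comul (R := k) a) =
      Coalgebra.counit (R := k) a • 1 := by
  rw [← CoalgHomClass.counit_comp_apply φ, ← antipode_right_smul (φ a)]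
  exact congr((LinearMap.mul' k H ∘ₗ (HopfAlgebra.antipode k).lTensor H)
    $(CoalgHomClass.map_comp_comul_apply φ a))

/-- The relation `hI` turns h₁φ(a₁) ⊗ (v ⊗ S(φ(a₂))S(h₂)w) into h₁ ⊗ (a₁v ⊗ φ(a₂)S(φ(a₃))S(h₂)w),
and the last two factors of a collapse. Here `I` stands for the canonical map into the induced
module; balancedness is the only property of it that enters. -/
theorem rprojInvAux_balanced {I : H →ₗ[k] V ⊗[k] W →ₗ[k] P}
    (hI : ∀ h a x, I (h * φ a) x = I h (tensorAct ρ (σ.comp (φ : K →ₐ[k] H)) a x))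
    (h : H) (a : K) (v : V) (w : W) :
    rprojInvAux σ I (Coalgebra.comul (R := k) (h * φ a)) (v ⊗ₜ w) =
      rprojInvAux σ I (Coalgebra.comul (R := k) h) (ρ a v ⊗ₜ w) := by
  rw [comul_mul_map]
  induction Coalgebra.comul (R := k) h using TensorProduct.induction_on with
  | zero => simp
  | add x y hx hy => simp only [add_mul, map_add, LinearMap.add_apply, hx, hy]
  | tmul x y =>
    refine (comul_eq_of_coassoc_right (antipode_right_smul_map φ)
      (((TensorProduct.mk k V W).compr₂ (I x)).compl₁₂ (orb ρ v)
        (orb σ (σ (HopfAlgebra.antipode k y) w)))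
      ((rprojInvAux σ I).flip (v ⊗ₜ w) ∘ₗ LinearMap.mulLeft k (x ⊗ₜ y) ∘ₗ
        TensorProduct.map (φ : K →ₗ[k] H) (φ : K →ₗ[k] H)) (fun b c => ?_) a).trans ?_
    · simp [hI, tensorAct_tmul, HopfAlgebra.antipode_mul_antidistrib]
      induction Coalgebra.comul (R := k) b using TensorProduct.induction_on with
      | zero => simp
      | add x y hx hy => simp only [TensorProduct.add_tmul, map_add, hx, hy]
      | tmul b₁ b₂ => simp
    · simp

/-- The composite is h₁ ⊗ (v ⊗ S(h₂)h₃w), so the left antipode axiom applies. The opposite composite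
below is (h₁ ⊗ v) ⊗ h₂S(h₃)w and takes the right one. `I` and `J` stand for the canonical maps into
the two induced modules, `R` for the projection morphism and `T` for its inverse. -/
theorem rprojInv_comp_rproj {I : H →ₗ[k] V ⊗[k] W →ₗ[k] P} {J : H →ₗ[k] V →ₗ[k] Q}
    {R : P →ₗ[k] Q ⊗[k] W} {T : Q ⊗[k] W →ₗ[k] P}
    (hR : ∀ h v w, R (I h (v ⊗ₜ w)) =
      TensorProduct.map (J.flip v) (orb σ w) (Coalgebra.comul (R := k) h))
    (hT : ∀ h v w, T (J h v ⊗ₜ w) = rprojInvAux σ I (Coalgebra.comul (R := k) h) (v ⊗ₜ w))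
    (h : H) (v : V) (w : W) : T (R (I h (v ⊗ₜ w))) = I h (v ⊗ₜ w) := by
  rw [hR]
  refine (comul_eq_of_coassoc_right antipode_left_smul (I.compl₂ (TensorProduct.mk k V W v ∘ₗ
    orb σ w)) (T ∘ₗ TensorProduct.map (J.flip v) (orb σ w)) (fun a b => ?_) h).trans ?_
  · simp only [LinearMap.comp_apply, TensorProduct.map_tmul, LinearMap.flip_apply, hT, orb_apply]
    induction Coalgebra.comul (R := k) a using TensorProduct.induction_on with
    | zero => simp
    | add x y hx hy => simp only [TensorProduct.add_tmul, map_add, LinearMap.add_apply, hx, hy]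
    | tmul x y => simp
  · simp

theorem rproj_comp_rprojInv {I : H →ₗ[k] V ⊗[k] W →ₗ[k] P} {J : H →ₗ[k] V →ₗ[k] Q}
    {R : P →ₗ[k] Q ⊗[k] W} {T : Q ⊗[k] W →ₗ[k] P}
    (hR : ∀ h v w, R (I h (v ⊗ₜ w)) =
      TensorProduct.map (J.flip v) (orb σ w) (Coalgebra.comul (R := k) h))
    (hT : ∀ h v w, T (J h v ⊗ₜ w) = rprojInvAux σ I (Coalgebra.comul (R := k) h) (v ⊗ₜ w))
    (h : H) (v : V) (w : W) : R (T (J h v ⊗ₜ w)) = J h v ⊗ₜ w := by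
  rw [hT]
  refine (comul_eq_of_coassoc_right antipode_right_smul ((TensorProduct.mk k Q W).compl₁₂ (J.flip v)
    (orb σ w)) (R ∘ₗ (rprojInvAux σ I).flip (v ⊗ₜ w)) (fun a b => ?_) h).trans ?_
  · simp only [LinearMap.comp_apply, LinearMap.flip_apply, rprojInvAux_tmul, hR]
    induction Coalgebra.comul (R := k) a using TensorProduct.induction_on with
    | zero => simp
    | add x y hx hy => simp only [TensorProduct.add_tmul, map_add, hx, hy]
    | tmul x y => simp
  · simp

variable [InvertibleAntipode k H]

/-- The map `a ⊗ b ↦ (w ⊗ v ↦ b ⊗ (S⁻¹(a) w ⊗ v))`. -/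
def lprojInvAux (I : H →ₗ[k] W ⊗[k] V →ₗ[k] P) : H ⊗[k] H →ₗ[k] W ⊗[k] V →ₗ[k] P :=
  TensorProduct.lift <| ((LinearMap.llcomp k (W ⊗[k] V) (W ⊗[k] V) P ∘ₗ I).compl₂
    (LinearMap.rTensorHom V ∘ₗ σ.toLinearMap ∘ₗ antipodeInv k H)).flip

@[simp]
theorem lprojInvAux_tmul (I : H →ₗ[k] W ⊗[k] V →ₗ[k] P) (a b : H) (w : W) (v : V) :
    lprojInvAux σ I (a ⊗ₜ b) (w ⊗ₜ v) = I b (σ (antipodeInv k H a) w ⊗ₜ[k] v) := rfl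

theorem antipodeInv_right_smul_map (a : K) :
    (LinearMap.mul' k H ∘ₗ (TensorProduct.comm k H H).toLinearMap ∘ₗ
      (antipodeInv k H).rTensor H ∘ₗ
      TensorProduct.map (φ : K →ₗ[k] H) (φ : K →ₗ[k] H)) (Coalgebra.comul (R := k) a) =
      Coalgebra.counit (R := k) a • 1 := by
  rw [← CoalgHomClass.counit_comp_apply φ, ← antipodeInv_right_smul (φ a)]
  exact congr((LinearMap.mul' k H ∘ₗ (TensorProduct.comm k H H).toLinearMap ∘ₗ
    (antipodeInv k H).rTensor H) $(CoalgHomClass.map_comp_comul_apply φ a))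

/-- Mirror image of `rprojInvAux_balanced`: since S⁻¹ reverses products, the factor φ(a₂)S⁻¹(φ(a₁))
appears in front of S⁻¹(h₁)w and collapses, leaving a₃v. On this side S would stand in the wrong
order, which is why its inverse is needed. -/
theorem lprojInvAux_balanced {I : H →ₗ[k] W ⊗[k] V →ₗ[k] P}
    (hI : ∀ h a x, I (h * φ a) x = I h (tensorAct (σ.comp (φ : K →ₐ[k] H)) ρ a x))
    (h : H) (a : K) (w : W) (v : V) :
    lprojInvAux σ I (Coalgebra.comul (R := k) (h * φ a)) (w ⊗ₜ v) =
      lprojInvAux σ I (Coalgebra.comul (R := k) h) (w ⊗ₜ ρ a v) := by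
  rw [comul_mul_map]
  induction Coalgebra.comul (R := k) h using TensorProduct.induction_on with
  | zero => simp
  | add x y hx hy => simp only [add_mul, map_add, LinearMap.add_apply, hx, hy]
  | tmul x y =>
    refine (comul_eq_of_coassoc_left (antipodeInv_right_smul_map φ)
      (((TensorProduct.mk k W V).compr₂ (I y)).compl₁₂ (orb σ (σ (antipodeInv k H x) w))
        (orb ρ v))
      ((lprojInvAux σ I).flip (w ⊗ₜ v) ∘ₗ LinearMap.mulLeft k (x ⊗ₜ y) ∘ₗ
        TensorProduct.map (φ : K →ₗ[k] H) (φ : K →ₗ[k] H)) (fun b c => ?_) a).trans ?_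
    · simp [hI, tensorAct_tmul, antipodeInv_mul]
      induction Coalgebra.comul (R := k) c using TensorProduct.induction_on with
      | zero => simp
      | add x y hx hy => simp only [TensorProduct.tmul_add, map_add, hx, hy]
      | tmul c₁ c₂ => simp
    · simp

/-- The composite is h₃ ⊗ (S⁻¹(h₂)h₁w ⊗ v); the opposite one below is h₂S⁻¹(h₁)w ⊗ (h₃ ⊗ v). -/
theorem lprojInv_comp_lproj {I : H →ₗ[k] W ⊗[k] V →ₗ[k] P} {J : H →ₗ[k] V →ₗ[k] Q}
    {R : P →ₗ[k] W ⊗[k] Q} {T : W ⊗[k] Q →ₗ[k] P}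
    (hR : ∀ h w v, R (I h (w ⊗ₜ v)) =
      TensorProduct.map (orb σ w) (J.flip v) (Coalgebra.comul (R := k) h))
    (hT : ∀ h w v, T (w ⊗ₜ J h v) = lprojInvAux σ I (Coalgebra.comul (R := k) h) (w ⊗ₜ v))
    (h : H) (w : W) (v : V) : T (R (I h (w ⊗ₜ v))) = I h (w ⊗ₜ v) := by
  rw [hR]
  refine (comul_eq_of_coassoc_left antipodeInv_left_smul
    (I.compl₂ ((TensorProduct.mk k W V).flip v ∘ₗ orb σ w)).flip
    (T ∘ₗ TensorProduct.map (orb σ w) (J.flip v)) (fun a b => ?_) h).trans ?_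
  · simp only [LinearMap.comp_apply, TensorProduct.map_tmul, LinearMap.flip_apply, hT, orb_apply]
    induction Coalgebra.comul (R := k) b using TensorProduct.induction_on with
    | zero => simp
    | add x y hx hy => simp only [TensorProduct.tmul_add, map_add, LinearMap.add_apply, hx, hy]
    | tmul x y => simp
  · simp

theorem lproj_comp_lprojInv {I : H →ₗ[k] W ⊗[k] V →ₗ[k] P} {J : H →ₗ[k] V →ₗ[k] Q}
    {R : P →ₗ[k] W ⊗[k] Q} {T : W ⊗[k] Q →ₗ[k] P}
    (hR : ∀ h w v, R (I h (w ⊗ₜ v)) =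
      TensorProduct.map (orb σ w) (J.flip v) (Coalgebra.comul (R := k) h))
    (hT : ∀ h w v, T (w ⊗ₜ J h v) = lprojInvAux σ I (Coalgebra.comul (R := k) h) (w ⊗ₜ v))
    (h : H) (w : W) (v : V) : R (T (w ⊗ₜ J h v)) = w ⊗ₜ J h v := by
  rw [hT]
  refine (comul_eq_of_coassoc_left antipodeInv_right_smul
    ((TensorProduct.mk k W Q).compl₁₂ (orb σ w) (J.flip v))
    (R ∘ₗ (lprojInvAux σ I).flip (w ⊗ₜ v)) (fun a b => ?_) h).trans ?_
  · simp only [LinearMap.comp_apply, LinearMap.flip_apply, lprojInvAux_tmul, hR]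
    induction Coalgebra.comul (R := k) b using TensorProduct.induction_on with
    | zero => simp
    | add x y hx hy => simp only [TensorProduct.tmul_add, map_add, hx, hy]
    | tmul x y => simp
  · simp

end ProjectionInverse

/-! ### The projection formula for induction -/

section IndProjection

variable {k K H : Type u} [CommRing k] [Ring K] [Ring H] [Bialgebra k K] [HopfAlgebra k H]
  (φ : K →ₐc[k] H)

omit [HopfAlgebra k H] in
theorem ind_tensor_ext [Bialgebra k H] (φ : K →ₐc[k] H) {V W : LMod k K} {X : Type u}
    [AddCommGroup X] [Module k X] {f g : IndCarrier φ (V ⊗ W) →ₗ[k] X}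
    (w : ∀ h (v : V) (w : W), f (indMk h (v ⊗ₜ[k] w)) = g (indMk h (v ⊗ₜ[k] w))) : f = g :=
  ind_ext φ fun h x => LinearMap.congr_fun (TensorProduct.ext' (w h) :
    f ∘ₗ indMkBil φ (V ⊗ W) h = g ∘ₗ indMkBil φ (V ⊗ W) h) x

theorem LMod.isIso_of_inverse {A : Type u} [Ring A] [Algebra k A] {V W : LMod k A} (f : V ⟶ W)
    (g : W →ₗ[k] V) (hgf : g ∘ₗ f.lin = LinearMap.id) (hfg : f.lin ∘ₗ g = LinearMap.id) :
    IsIso f :=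
  (LMod.isoMk (LinearEquiv.ofLinearMap f.lin g hfg hgf) f.comm).isIso_hom

/-- The map `(h, v ⊗ w) ↦ h ⊗ (v ⊗ w)` into `H ⊗_K (V ⊗ Res W)`. -/
def indMkRes (V : LMod k K) (W : LMod k H) :
    H →ₗ[k] V ⊗[k] W →ₗ[k] IndCarrier φ (V ⊗ (resFunctor φ).obj W) :=
  indMkBil φ (V ⊗ (resFunctor φ).obj W)

/-- The inverse `(h ⊗ v) ⊗ w ↦ h₁ ⊗ (v ⊗ S(h₂) w)` of the right projection morphism. -/
def rprojInv (V : LMod k K) (W : LMod k H) :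
    IndCarrier φ V ⊗[k] W →ₗ[k] IndCarrier φ (V ⊗ (resFunctor φ).obj W) :=
  TensorProduct.lift <| indLift φ (TensorProduct.lift <|
    TensorProduct.lcurry (.id k) V W (IndCarrier φ (V ⊗ (resFunctor φ).obj W)) ∘ₗ
      rprojInvAux W.act (indMkRes φ V W) ∘ₗ Coalgebra.comul)
    fun h a v => LinearMap.ext fun w => rprojInvAux_balanced φ V.act W.act
      (fun h a x => indMk_mul φ (V := V ⊗ (resFunctor φ).obj W) h a x) h a v w

theorem rprojInv_mk (V : LMod k K) (W : LMod k H) (h : H) (v : V) (w : W) :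
    rprojInv φ V W (indMkBil φ V h v ⊗ₜ w) =
      rprojInvAux W.act (indMkRes φ V W) (Coalgebra.comul (R := k) h) (v ⊗ₜ w) := rfl

theorem isIso_rproj_indResAdj (V : LMod k K) (W : LMod k H) :
    IsIso (rproj (indResAdj φ) V W) := by
  refine LMod.isIso_of_inverse _ (rprojInv φ V W) ?_ ?_
  · exact ind_tensor_ext φ fun h v w =>
      rprojInv_comp_rproj W.act (rproj_lin_mk φ V W) (rprojInv_mk φ V W) h v w
  · refine TensorProduct.ext <| ind_ext φ fun h v => LinearMap.ext fun w => ?_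
    exact rproj_comp_rprojInv W.act (rproj_lin_mk φ V W) (rprojInv_mk φ V W) h v w

variable [InvertibleAntipode k H]

/-- The map `(h, w ⊗ v) ↦ h ⊗ (w ⊗ v)` into `H ⊗_K (Res W ⊗ V)`. -/
def indMkResLeft (W : LMod k H) (V : LMod k K) :
    H →ₗ[k] W ⊗[k] V →ₗ[k] IndCarrier φ ((resFunctor φ).obj W ⊗ V) :=
  indMkBil φ ((resFunctor φ).obj W ⊗ V)

/-- The inverse `w ⊗ (h ⊗ v) ↦ h₂ ⊗ (S⁻¹(h₁) w ⊗ v)` of the left projection morphism. -/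
def lprojInv (W : LMod k H) (V : LMod k K) :
    W ⊗[k] IndCarrier φ V →ₗ[k] IndCarrier φ ((resFunctor φ).obj W ⊗ V) :=
  TensorProduct.lift <| LinearMap.flip <| indLift φ (TensorProduct.lift <|
    TensorProduct.lcurry (.id k) V W (IndCarrier φ ((resFunctor φ).obj W ⊗ V)) ∘ₗ
      LinearMap.lcomp k _ (TensorProduct.comm k V W).toLinearMap ∘ₗ
      lprojInvAux W.act (indMkResLeft φ W V) ∘ₗ Coalgebra.comul)
    fun h a v => LinearMap.ext fun w => lprojInvAux_balanced φ V.act W.act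
      (fun h a x => indMk_mul φ (V := (resFunctor φ).obj W ⊗ V) h a x) h a w v

theorem lprojInv_mk (W : LMod k H) (V : LMod k K) (h : H) (w : W) (v : V) :
    lprojInv φ W V (w ⊗ₜ indMkBil φ V h v) =
      lprojInvAux W.act (indMkResLeft φ W V) (Coalgebra.comul (R := k) h) (w ⊗ₜ v) := rfl

theorem isIso_lproj_indResAdj (W : LMod k H) (V : LMod k K) :
    IsIso (lproj (indResAdj φ) W V) := by
  refine LMod.isIso_of_inverse _ (lprojInv φ W V) ?_ ?_
  · exact ind_tensor_ext φ fun h w v =>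
      lprojInv_comp_lproj W.act (lproj_lin_mk φ V W) (lprojInv_mk φ W V) h w v
  · refine TensorProduct.ext <| LinearMap.ext fun w => ind_ext φ fun h v => ?_
    exact lproj_comp_lprojInv W.act (lproj_lin_mk φ V W) (lprojInv_mk φ W V) h w v

theorem projectionFormula_indResAdj : ProjectionFormula (indResAdj φ) where
  isIso_lproj := isIso_lproj_indResAdj φ
  isIso_rproj := isIso_rproj_indResAdj φ

end IndProjection

/-! ### Half-braidings as Yetter-Drinfeld structures -/

section HalfBraidingYD

variable {k H : Type u} [CommRing k] [Ring H]

/-- The left regular module. -/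
def LMod.regular (k H : Type u) [CommRing k] [Ring H] [Algebra k H] : LMod k H :=
  ⟨H, Algebra.lmul k H⟩

section Bialgebra

variable [Bialgebra k H] {V : LMod k H}

/-- The orbit map `h ↦ h w` as a morphism of left modules. -/
def LMod.orbHom (W : LMod k H) (w : W) : LMod.regular k H ⟶ W where
  lin := (orb W.act w : H →ₗ[k] W)
  comm (g h : H) := by
    change W.act (g * h) w = W.act g (W.act h w)
    rw [map_mul]; rfl

/-- The coaction `v ↦ c (v ⊗ 1)` of a half-braiding `c`. -/
def halfBraidingCoact (c : HalfBraiding V) : V →ₗ[k] H ⊗[k] V :=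
  (c.β (LMod.regular k H)).hom.lin ∘ₗ (TensorProduct.mk k V H).flip 1

/-- Since w is the image of 1 under the orbit map from the regular module, naturality along that map
determines c(v ⊗ w) from c(v ⊗ 1). -/
theorem halfBraiding_lin (c : HalfBraiding V) (W : LMod k H) :
    (c.β W).hom.lin = braidMap (halfBraidingCoact c) W.act := by
  refine TensorProduct.ext' fun v w => ?_
  have h1 := congr($(congrArg LMod.Hom.lin (c.naturality (LMod.orbHom W w))) (v ⊗ₜ (1 : H)))
  have h2 : (v ⊗ₜ w : V ⊗[k] W) = v ⊗ₜ W.act 1 w := by rw [map_one]; rfl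
  exact (congrArg (c.β W).hom.lin h2).trans h1

theorem orb_lmul_one : orb (Algebra.lmul k H) 1 = LinearMap.id :=
  LinearMap.ext fun h => mul_one h

/-- Evaluate the hexagon axiom for two copies of the regular module at v ⊗ (1 ⊗ 1): `H` acts on 1 ⊗
1 by comultiplication, which gives one side, and the iterated braiding gives the other. -/
theorem halfBraidingCoact_coassoc (c : HalfBraiding V) (v : V) :
    TensorProduct.assoc k H H V (Coalgebra.comul.rTensor V (halfBraidingCoact c v)) =
      (halfBraidingCoact c).lTensor H (halfBraidingCoact c v) := by
  -- The half-braidings enter as variables `f` and `g` so that they can be replaced by `braidMap`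
  -- afterwards.
  have h1 : ∀ (f : V ⊗[k] H →ₗ[k] H ⊗[k] V) (g : V ⊗[k] (H ⊗[k] H) →ₗ[k] (H ⊗[k] H) ⊗[k] V),
      (c.β (LMod.regular k H)).hom.lin = f →
      (c.β (LMod.regular k H ⊗ LMod.regular k H)).hom.lin = g →
      g (v ⊗ₜ (1 ⊗ₜ 1)) = (TensorProduct.assoc k H H V).symm (f.lTensor H
        (TensorProduct.assoc k H V H (f.rTensor H
          ((TensorProduct.assoc k V H H).symm (v ⊗ₜ (1 ⊗ₜ 1)))))) := by
    rintro _ _ rfl rfl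
    exact congr($(congrArg LMod.Hom.lin
      (c.monoidal (LMod.regular k H) (LMod.regular k H))) (v ⊗ₜ ((1 : H) ⊗ₜ[k] (1 : H))))
  have h2 : ∀ p : H ⊗[k] V, (braidMap (halfBraidingCoact c) (Algebra.lmul k H)).lTensor H
      (TensorProduct.assoc k H V H (p ⊗ₜ 1)) = (halfBraidingCoact c).lTensor H p := by
    intro p
    induction p using TensorProduct.induction_on with
    | zero => simp
    | add x y hx hy => simp only [map_add, TensorProduct.add_tmul, hx, hy]
    | tmul a v => simp [braidMap_tmul, orb_lmul_one]
  have h3 := h1 (braidMap (halfBraidingCoact c) (Algebra.lmul k H))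
    (braidMap (halfBraidingCoact c) (tensorAct (Algebra.lmul k H) (Algebra.lmul k H)))
    (halfBraiding_lin c (LMod.regular k H)) (halfBraiding_lin c (LMod.regular k H ⊗ LMod.regular k H))
  rw [LinearEquiv.eq_symm_apply, TensorProduct.assoc_symm_tmul, LinearMap.rTensor_tmul] at h3
  have h4 : braidMap (halfBraidingCoact c) (tensorAct (Algebra.lmul k H) (Algebra.lmul k H))
      (v ⊗ₜ ((1 : H) ⊗ₜ[k] (1 : H))) = Coalgebra.comul.rTensor V (halfBraidingCoact c v) := by
    rw [braidMap_tmul, orb_tensorAct, orb_lmul_one, TensorProduct.map_id, LinearMap.id_comp]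
  rw [← h4, ← h2]
  refine h3.trans ?_
  change (braidMap (halfBraidingCoact c) (Algebra.lmul k H)).lTensor H
    (TensorProduct.assoc k H V H ((orb (Algebra.lmul k H) 1).rTensor V
      (halfBraidingCoact c v) ⊗ₜ 1)) = _
  rw [orb_lmul_one, LinearMap.rTensor_id, LinearMap.id_apply]

/-- The axioms of a half-braiding do not prescribe its value on the unit object. The map p(v) =
ε(v⁽⁻¹⁾)v⁽⁰⁾ is that value up to unitors, hence injective; coassociativity makes it idempotent, and
an injective idempotent map is the identity. -/
theorem halfBraidingCoact_counit (c : HalfBraiding V) (v : V) :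
    TensorProduct.lid k V (Coalgebra.counit.rTensor V (halfBraidingCoact c v)) = v := by
  set p : V →ₗ[k] V := (TensorProduct.lid k V).toLinearMap ∘ₗ Coalgebra.counit.rTensor V ∘ₗ
    halfBraidingCoact c with hp
  have hinj : Function.Injective p := by
    have h1 : p = (TensorProduct.lid k V).toLinearMap ∘ₗ (c.β (𝟙_ (LMod k H))).hom.lin ∘ₗ
        (TensorProduct.rid k V).symm.toLinearMap := by
      ext v
      rw [halfBraiding_lin]
      simp only [LinearMap.comp_apply, LinearEquiv.coe_coe, TensorProduct.rid_symm_apply, hp]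
      refine congr(TensorProduct.lid k V (LinearMap.rTensor V $(?_) (halfBraidingCoact c v)))
      exact LinearMap.ext fun h => (mul_one _).symm
    have h2 : Function.LeftInverse (c.β (𝟙_ (LMod k H))).inv.lin
        (c.β (𝟙_ (LMod k H))).hom.lin := fun x =>
      congr($(congrArg LMod.Hom.lin (c.β (𝟙_ (LMod k H))).hom_inv_id) x)
    rw [h1]
    exact (TensorProduct.lid k V).injective.comp
      (h2.injective.comp (TensorProduct.rid k V).symm.injective)
  refine hinj ?_
  change p (p v) = p v
  have h1 : p ∘ₗ (TensorProduct.lid k V).toLinearMap ∘ₗ Coalgebra.counit.rTensor V =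
      (TensorProduct.lid k V).toLinearMap ∘ₗ TensorProduct.map Coalgebra.counit
        ((TensorProduct.lid k V).toLinearMap ∘ₗ Coalgebra.counit.rTensor V) ∘ₗ
        (halfBraidingCoact c).lTensor H :=
    TensorProduct.ext' fun a v => by simp [hp]
  have h2 : (TensorProduct.lid k V).toLinearMap ∘ₗ TensorProduct.map Coalgebra.counit
        ((TensorProduct.lid k V).toLinearMap ∘ₗ Coalgebra.counit.rTensor V) ∘ₗ
        (TensorProduct.assoc k H H V).toLinearMap =
      (TensorProduct.lid k V).toLinearMap ∘ₗ (Coalgebra.counit ∘ₗ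
        (TensorProduct.lid k H).toLinearMap ∘ₗ Coalgebra.counit.rTensor H).rTensor V :=
    TensorProduct.ext_threefold fun a b v => by
      simpa [mul_smul] using smul_comm _ _ _
  have h3 := congr($h1 (halfBraidingCoact c v))
  have h4 := congr($h2 (Coalgebra.comul.rTensor V (halfBraidingCoact c v)))
  simp only [LinearMap.comp_apply, LinearEquiv.coe_coe] at h3 h4
  rw [halfBraidingCoact_coassoc, ← h3, ← LinearMap.rTensor_comp_apply] at h4
  refine h4.trans ?_
  have h5 : (Coalgebra.counit ∘ₗ (TensorProduct.lid k H).toLinearMap ∘ₗ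
      Coalgebra.counit.rTensor H) ∘ₗ Coalgebra.comul = Coalgebra.counit (R := k) (A := H) := by
    ext h; simp
  rw [h5]
  rfl

/-- The Yetter-Drinfeld condition is `H`-linearity of the half-braiding on the regular module,
evaluated at v ⊗ 1, where h acts as h₁v ⊗ h₂. -/
theorem halfBraidingCoact_yd (c : HalfBraiding V) (v : V) :
    ydLeft V.act (halfBraidingCoact c v) ∘ₗ Coalgebra.comul =
      ydRight V.act (halfBraidingCoact c) v ∘ₗ Coalgebra.comul := by
  ext h
  have h1 : ∀ f : V ⊗[k] H →ₗ[k] H ⊗[k] V, (c.β (LMod.regular k H)).hom.lin = f →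
      f (tensorAct V.act (Algebra.lmul k H) h (v ⊗ₜ 1)) =
        tensorAct (Algebra.lmul k H) V.act h (f (v ⊗ₜ 1)) := by
    rintro _ rfl
    exact (c.β (LMod.regular k H)).hom.comm h (v ⊗ₜ (1 : H))
  have h2 : braidMap (halfBraidingCoact c) (Algebra.lmul k H) ∘ₗ
      TensorProduct.map (orb V.act v) LinearMap.id = ydRight V.act (halfBraidingCoact c) v :=
    TensorProduct.ext' fun a b => rfl
  have h3 : ∀ p : H ⊗[k] V, tensorAct (Algebra.lmul k H) V.act h p =
      ydLeft V.act p (Coalgebra.comul (R := k) h) := by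
    intro p
    induction p using TensorProduct.induction_on with
    | zero => simp [ydLeft]
    | add x y hx hy => simp only [map_add, hx, hy, ydLeft, LinearMap.add_apply]
    | tmul a v =>
      rw [tensorAct_tmul]
      induction Coalgebra.comul (R := k) h using TensorProduct.induction_on with
      | zero => simp
      | add x y hx hy => simp only [map_add, hx, hy]
      | tmul b d => rfl
  have h4 := h1 (braidMap (halfBraidingCoact c) (Algebra.lmul k H))
    (halfBraiding_lin c (LMod.regular k H))
  rw [tensorAct_tmul, orb_lmul_one, h3] at h4
  rw [LinearMap.comp_apply, LinearMap.comp_apply, ← h2, LinearMap.comp_apply]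
  refine Eq.trans ?_ h4.symm
  change _ = ydLeft V.act ((orb (Algebra.lmul k H) 1).rTensor V (halfBraidingCoact c v)) _
  rw [orb_lmul_one, LinearMap.rTensor_id, LinearMap.id_apply]

/-- The Yetter-Drinfeld structure of a half-braiding. -/
def HalfBraiding.toYDStruct (c : HalfBraiding V) : YDStruct V where
  coact := halfBraidingCoact c
  isYD := ⟨halfBraidingCoact_coassoc c, halfBraidingCoact_counit c,
    yd_of (halfBraidingCoact_yd c)⟩

theorem HalfBraiding.toYDStruct_braid (c : HalfBraiding V) (W : LMod k H) :
    (HalfBraiding.toYDStruct c).braid W = (c.β W).hom :=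
  LMod.hom_ext (halfBraiding_lin c W).symm

end Bialgebra

variable [HopfAlgebra k H] [InvertibleAntipode k H]

/-- The half-braiding of a Yetter-Drinfeld structure. -/
def YDStruct.toHalfBraiding {V : LMod k H} (y : YDStruct V) : HalfBraiding V where
  β W := LMod.isoMk (V := V ⊗ W) (W := W ⊗ V) (LinearEquiv.ofLinearMap (braidMap y.coact W.act)
    (braidInv y.coact W.act) (LinearMap.ext <| braidMap_braidInv y.isYD W.act)
    (LinearMap.ext <| braidInv_braidMap y.isYD W.act)) (braidMap_equivariant y.isYD W.act)
  monoidal W U := LMod.hom_ext <| TensorProduct.ext_threefold' fun v w u =>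
    (TensorProduct.assoc k W U V).eq_symm_apply.mpr
      (braidMap_tensor_right y.isYD W.act U.act v w u)
  naturality g := LMod.hom_ext <| TensorProduct.ext' fun v w =>
    braidMap_natural_right y.coact g.lin g.comm v w

end HalfBraidingYD

/-! ### Testing colinearity through braidings -/

section YDBraid

variable {k H : Type u} [CommRing k] [Ring H] [Bialgebra k H]

theorem braidMap_lmul_one {V : Type u} [AddCommGroup V] [Module k V] (δ : V →ₗ[k] H ⊗[k] V)
    (v : V) : braidMap δ (Algebra.lmul k H) (v ⊗ₜ 1) = δ v := by
  rw [braidMap_tmul, orb_lmul_one, LinearMap.rTensor_id, LinearMap.id_apply]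

/-- Evaluation at v ⊗ 1 recovers the coactions from the braidings with the regular module.
Colinearity thus reduces to the condition for a morphism in the center. -/
theorem colinear_of_braid {V W : LMod k H} (y : YDStruct V) (z : YDStruct W) (f : V ⟶ W)
    (hf : f ▷ LMod.regular k H ≫ z.braid (LMod.regular k H) =
      y.braid (LMod.regular k H) ≫ LMod.regular k H ◁ f) :
    Colinear y.coact z.coact f.lin := by
  intro v
  rw [← braidMap_lmul_one, ← braidMap_lmul_one]
  exact congr($(congrArg LMod.Hom.lin hf) (v ⊗ₜ (1 : H)))

theorem YD.braid_natural {V W : YD k H} (f : V ⟶ W) (U : LMod k H) :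
    f.hom ▷ U ≫ W.str.braid U = V.str.braid U ≫ U ◁ f.hom :=
  LMod.hom_ext <| TensorProduct.ext' fun v u => braidMap_natural_left f.colinear U.act v u

/-- The codiagonal coaction corresponds to the half-braiding of a tensor product in the center,
which lets the results on centers be applied to `YD`. -/
theorem YD.tensor_braid (V W : YD k H) (U : LMod k H) :
    (V ⊗ W).str.braid U = (α_ V.toLMod W.toLMod U).hom ≫ V.toLMod ◁ W.str.braid U ≫
      (α_ V.toLMod U W.toLMod).inv ≫ V.str.braid U ▷ W.toLMod ≫ (α_ U V.toLMod W.toLMod).hom :=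
  LMod.hom_ext <| TensorProduct.ext_threefold fun v w u =>
    braidMap_tensor_left V.str.coact W.str.coact U.act v w u

theorem YD.unit_braid (U : LMod k H) :
    (𝟙_ (YD k H)).str.braid U = (λ_ U).hom ≫ (ρ_ U).inv :=
  LMod.hom_ext <| TensorProduct.ext' fun x u => by
    change U.act 1 u ⊗ₜ[k] x = (x • u) ⊗ₜ[k] (1 : k)
    rw [map_one, TensorProduct.smul_tmul, smul_eq_mul, mul_one]
    rfl

end YDBraid

/-! ### Evaluating the induced half-braiding -/

section Coaction

variable {k H : Type u} [CommRing k] [Ring H] [HopfAlgebra k H]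
  {V P Q : Type u} [AddCommGroup V] [Module k V] [AddCommGroup P] [Module k P]
  [AddCommGroup Q] [Module k Q]

/-- The map `p ⊗ (q ⊗ r) ↦ p f S(r) ⊗ J(q, w)`. -/
def conjMap (J : H →ₗ[k] V →ₗ[k] Q) (f : H) (w : V) : H ⊗[k] (H ⊗[k] H) →ₗ[k] H ⊗[k] Q :=
  TensorProduct.map (LinearMap.mul' k H ∘ₗ
      (LinearMap.mulLeft k f ∘ₗ HopfAlgebra.antipode k).lTensor H) (J.flip w) ∘ₗ
    (TensorProduct.assoc k H H H).symm.toLinearMap ∘ₗ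
    (TensorProduct.comm k H H).toLinearMap.lTensor H

@[simp]
theorem conjMap_tmul (J : H →ₗ[k] V →ₗ[k] Q) (f : H) (w : V) (p q r : H) :
    conjMap J f w (p ⊗ₜ (q ⊗ₜ r)) = (p * f * HopfAlgebra.antipode k r) ⊗ₜ J q w := by
  simp [conjMap, mul_assoc]

/-- `F` stands for `lproj` after the induced map of the half-braiding, and the sum over `t` for the
coaction of v. Applied to h₁ ⊗ (v ⊗ S(h₂)), it comultiplies h₁ once more, and coassociativity brings
the threefold coproduct into the form h₁ ⊗ (h₂ ⊗ h₃). -/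
theorem map_rprojInvAux_comul {I : H →ₗ[k] V ⊗[k] H →ₗ[k] P} {J : H →ₗ[k] V →ₗ[k] Q}
    {F : P →ₗ[k] H ⊗[k] Q} {κ : Type u} {t : Finset κ} {f : κ → H} {w : κ → V} {v : V}
    (hF : ∀ g r, F (I g (v ⊗ₜ r)) = ∑ j ∈ t,
      TensorProduct.map (orb (Algebra.lmul k H) (f j * r)) (J.flip (w j))
        (Coalgebra.comul (R := k) g)) (h : H) :
    F (rprojInvAux (Algebra.lmul k H) I (Coalgebra.comul (R := k) h) (v ⊗ₜ 1)) =
      ∑ j ∈ t, conjMap J (f j) (w j) (Coalgebra.comul.lTensor H (Coalgebra.comul (R := k) h)) := by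
  have h1 : F ∘ₗ (rprojInvAux (Algebra.lmul k H) I).flip (v ⊗ₜ 1) =
      ∑ j ∈ t, conjMap J (f j) (w j) ∘ₗ (TensorProduct.assoc k H H H).toLinearMap ∘ₗ
        Coalgebra.comul.rTensor H := by
    refine TensorProduct.ext' fun a b => ?_
    simp only [LinearMap.comp_apply, LinearMap.flip_apply, rprojInvAux_tmul, hF,
      LinearMap.sum_apply, LinearMap.rTensor_tmul, LinearEquiv.coe_coe]
    refine Finset.sum_congr rfl fun j _ => ?_
    induction Coalgebra.comul (R := k) a using TensorProduct.induction_on with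
    | zero => simp
    | add x y hx hy => simp only [TensorProduct.add_tmul, map_add, hx, hy]
    | tmul x y => simp [mul_assoc]
  rw [← Coalgebra.coassoc_apply]
  simpa using congr($h1 (Coalgebra.comul (R := k) h))

end Coaction

/-! ### Induction of Yetter-Drinfeld modules -/

section InducedYD

variable {k K H : Type u} [CommRing k] [Ring K] [Ring H] [HopfAlgebra k K] [HopfAlgebra k H]
  [InvertibleAntipode k K] [InvertibleAntipode k H] (φ : K →ₐc[k] H)

/-- The Yetter-Drinfeld structure on an induced module. -/
def indYDStruct (V : YD k K) : YDStruct ((indFunctor φ).obj V.toLMod) :=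
  HalfBraiding.toYDStruct
    (inducedHalfBraiding (projectionFormula_indResAdj φ) V.str.toHalfBraiding)

theorem indYDStruct_braid (V : YD k K) (W : LMod k H) :
    (indYDStruct φ V).braid W = inducedBraid (projectionFormula_indResAdj φ) V.toLMod W
      (V.str.braid ((resFunctor φ).obj W)) :=
  HalfBraiding.toYDStruct_braid _ W

theorem colinear_indFunctor_map {V W : YD k K} (f : V ⟶ W) :
    Colinear (indYDStruct φ V).coact (indYDStruct φ W).coact ((indFunctor φ).map f.hom).lin := by
  refine colinear_of_braid _ _ _ ?_
  rw [indYDStruct_braid, indYDStruct_braid]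
  exact inducedHalfBraiding_natural (projectionFormula_indResAdj φ)
    (X := ⟨V.toLMod, V.str.toHalfBraiding⟩) (Y := ⟨W.toLMod, W.str.toHalfBraiding⟩)
    ⟨f.hom, YD.braid_natural f⟩ (LMod.regular k H)

/-- Induction of Yetter-Drinfeld modules. -/
abbrev indYDFunctor : YD k K ⥤ YD k H :=
  ydFunctor (indFunctor φ) (indYDStruct φ) (colinear_indFunctor_map φ)

/-- The oplax structure maps of induction, as morphisms of Yetter-Drinfeld modules. -/
def indYDδ (V W : YD k K) :
    (indYDFunctor φ).obj (V ⊗ W) ⟶ (indYDFunctor φ).obj V ⊗ (indYDFunctor φ).obj W where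
  hom := Functor.OplaxMonoidal.δ (indFunctor φ) V.toLMod W.toLMod
  colinear := by
    refine colinear_of_braid (indYDStruct φ (V ⊗ W))
      ((indYDFunctor φ).obj V ⊗ (indYDFunctor φ).obj W).str _ ?_
    rw [YD.tensor_braid, indYDStruct_braid, YD.tensor_braid]
    -- The structure on each image object is `indYDStruct` by definition; once this is visible, the
    -- claim is that δ is a morphism in the center.
    change _ ≫ _ ≫ _ ◁ (indYDStruct φ W).braid _ ≫ _ ≫ (indYDStruct φ V).braid _ ▷ _ ≫ _ = _
    rw [indYDStruct_braid, indYDStruct_braid]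
    exact δ_whiskerRight_comp_inducedBraid _ _ _

/-- The oplax unit map of induction, as a morphism of Yetter-Drinfeld modules. -/
def indYDη : (indYDFunctor φ).obj (𝟙_ (YD k K)) ⟶ 𝟙_ (YD k H) where
  hom := Functor.OplaxMonoidal.η (indFunctor φ)
  colinear := by
    refine colinear_of_braid (indYDStruct φ (𝟙_ (YD k K))) (𝟙_ (YD k H)).str _ ?_
    rw [YD.unit_braid, indYDStruct_braid, YD.unit_braid]
    exact η_whiskerRight_comp_unitors _ _

/-- The oplax monoidal structure on induction of Yetter-Drinfeld modules. -/
@[reducible]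
def indYDOplax : (indYDFunctor φ).OplaxMonoidal where
  η := indYDη φ
  δ := indYDδ φ
  δ_natural_left f W := YD.hom_ext <|
    Functor.OplaxMonoidal.δ_natural_left (indFunctor φ) f.hom W.toLMod
  δ_natural_right V f := YD.hom_ext <|
    Functor.OplaxMonoidal.δ_natural_right (indFunctor φ) V.toLMod f.hom
  oplax_associativity U V W := YD.hom_ext <|
    Functor.OplaxMonoidal.oplax_associativity (indFunctor φ) U.toLMod V.toLMod W.toLMod
  oplax_left_unitality V := YD.hom_ext <|
    Functor.OplaxMonoidal.oplax_left_unitality (indFunctor φ) V.toLMod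
  oplax_right_unitality V := YD.hom_ext <|
    Functor.OplaxMonoidal.oplax_right_unitality (indFunctor φ) V.toLMod

theorem isBraidedOplax_indYDFunctor : IsBraidedOplax (indYDFunctor φ) (indYDOplax φ) := by
  intro V W
  refine YD.hom_ext ?_
  refine (map_β_comp_δ (projectionFormula_indResAdj φ) V.str.toHalfBraiding W.toLMod).trans ?_
  exact congrArg (Functor.OplaxMonoidal.δ (indFunctor φ) V.toLMod W.toLMod ≫ ·)
    (indYDStruct_braid φ V ((indFunctor φ).obj W.toLMod)).symm

/-- The coaction is the induced half-braiding at (h ⊗ v) ⊗ 1. Arbitrary finite expressions of the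
threefold coproduct and of the coaction of v are allowed, so the formula does not depend on chosen
representatives. -/
theorem indYDStruct_coact_mk (V : YD k K) (h : H) (v : V.toLMod) {ι κ : Type u} (s : Finset ι)
    (a b c : ι → H) (t : Finset κ) (x : κ → K) (w : κ → V.toLMod)
    (hh : Coalgebra.comul.lTensor H (Coalgebra.comul (R := k) h) =
      ∑ i ∈ s, a i ⊗ₜ[k] (b i ⊗ₜ[k] c i))
    (hv : V.str.coact v = ∑ j ∈ t, x j ⊗ₜ[k] w j) :
    (indYDStruct φ V).coact (indMk h v : IndCarrier φ V.toLMod) =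
      ∑ i ∈ s, ∑ j ∈ t, (a i * φ (x j) * HopfAlgebra.antipode k (c i)) ⊗ₜ[k]
        (indMk (b i) (w j) : IndCarrier φ V.toLMod) := by
  have hF (g r : H) : (lproj (indResAdj φ) (LMod.regular k H) V.toLMod).lin
      (((indFunctor φ).map (V.str.braid ((resFunctor φ).obj (LMod.regular k H)))).lin
        (indMkRes φ V.toLMod (LMod.regular k H) g (v ⊗ₜ[k] r))) =
      ∑ j ∈ t, TensorProduct.map (orb (Algebra.lmul k H) (φ (x j) * r))
        ((indMkBil φ V.toLMod).flip (w j)) (Coalgebra.comul (R := k) g) := by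
    have h1 (T : H ⊗[k] V.toLMod →ₗ[k] H ⊗[k] IndCarrier φ V.toLMod) :
        T (braidMap V.str.coact ((Algebra.lmul k H).comp (φ : K →ₐ[k] H)) (v ⊗ₜ[k] r)) =
          ∑ j ∈ t, T ((φ (x j) * r) ⊗ₜ[k] w j) := by
      rw [braidMap_tmul, hv, map_sum, map_sum]
      rfl
    exact (h1 ((lproj (indResAdj φ) (LMod.regular k H) V.toLMod).lin ∘ₗ
      indMkResLeft φ (LMod.regular k H) V.toLMod g)).trans (Finset.sum_congr rfl fun j _ =>
        lproj_lin_mk φ V.toLMod (LMod.regular k H) g (φ (x j) * r) (w j))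
  have h3 := map_rprojInvAux_comul (I := indMkRes φ V.toLMod (LMod.regular k H))
    (J := indMkBil φ V.toLMod)
    (F := (lproj (indResAdj φ) (LMod.regular k H) V.toLMod).lin ∘ₗ
      ((indFunctor φ).map (V.str.braid ((resFunctor φ).obj (LMod.regular k H)))).lin) hF h
  -- `h4` writes (h ⊗ v) ⊗ 1 as `rproj` of an explicit element, at which the characterizing equation
  -- of the induced braiding is evaluated in `h5`; `h3` computes the result.
  have h4 := rproj_comp_rprojInv (LMod.regular k H).act (rproj_lin_mk φ V.toLMod (LMod.regular k H))
    (rprojInv_mk φ V.toLMod (LMod.regular k H)) h v (1 : H)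
  have h5 := congr($(congrArg LMod.Hom.lin (rproj_comp_inducedBraid
    (projectionFormula_indResAdj φ) V.toLMod (LMod.regular k H)
    (V.str.braid ((resFunctor φ).obj (LMod.regular k H)))))
    (rprojInv φ V.toLMod (LMod.regular k H) (indMkBil φ V.toLMod h v ⊗ₜ[k] (1 : H))))
  have h6 := (congrArg (inducedBraid (projectionFormula_indResAdj φ) V.toLMod (LMod.regular k H)
    (V.str.braid ((resFunctor φ).obj (LMod.regular k H)))).lin h4).symm.trans h5
  refine h6.trans (h3.trans ?_)
  rw [hh, Finset.sum_comm]
  simp only [map_sum, conjMap_tmul]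
  rfl

end InducedYD

end HopfInd

end

/-! ### Both statements assembled -/

theorem mainTheorem9 :
    (∀ (C : Type u₁) [Category.{v₁} C] [MonoidalCategory C]
      (D : Type u₂) [Category.{v₂} D] [MonoidalCategory D]
      (L : D ⥤ C) (G : C ⥤ D) [L.OplaxMonoidal] [G.Monoidal]
      (adj : L ⊣ G) [adj.IsMonoidal] (hp : ProjectionFormula adj),
      ∃ (b : ∀ X : Center D, HalfBraiding (L.obj X.1))
        (hb : ∀ {X Y : Center D} (f : X ⟶ Y) (A : C),
          L.map f.f ▷ A ≫ ((b Y).β A).hom = ((b X).β A).hom ≫ A ◁ L.map f.f)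
        (O : (centerFunctor L b hb).OplaxMonoidal),
        (∀ (X : Center D) (A : C),
          ((b X).β A).hom = inducedBraid hp X.1 A (X.2.β (G.obj A)).hom) ∧
        (∀ X Y : Center D, (O.δ X Y).f = Functor.OplaxMonoidal.δ L X.1 Y.1) ∧
        O.η.f = Functor.OplaxMonoidal.η L ∧
        IsBraidedOplax (centerFunctor L b hb) O) ∧
    (∀ (k K H : Type u) [Field k] [Ring K] [Ring H] [HopfAlgebra k K] [HopfAlgebra k H]
      [InvertibleAntipode k K] [InvertibleAntipode k H] (φ : K →ₐc[k] H),
      ∃ (hp : ProjectionFormula (indResAdj φ))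
        (δ : ∀ V : YD k K, YDStruct ((indFunctor φ).obj V.toLMod))
        (hδ : ∀ {V W : YD k K} (f : V ⟶ W),
          Colinear (δ V).coact (δ W).coact ((indFunctor φ).map f.hom).lin)
        (O : (ydFunctor (indFunctor φ) δ hδ).OplaxMonoidal),
        (∀ (V : YD k K) (h : H) (v : V.toLMod) {ι κ : Type u} (s : Finset ι) (a b c : ι → H)
          (t : Finset κ) (x : κ → K) (w : κ → V.toLMod),
          Coalgebra.comul.lTensor H (Coalgebra.comul (R := k) h) =
            ∑ i ∈ s, a i ⊗ₜ[k] (b i ⊗ₜ[k] c i) →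
          V.str.coact v = ∑ j ∈ t, x j ⊗ₜ[k] w j →
          (δ V).coact (indMk h v : IndCarrier φ V.toLMod) =
            ∑ i ∈ s, ∑ j ∈ t, (a i * φ (x j) * HopfAlgebra.antipode k (c i)) ⊗ₜ[k]
              (indMk (b i) (w j) : IndCarrier φ V.toLMod)) ∧
        (∀ (V : YD k K) (W : LMod k H),
          (δ V).braid W = inducedBraid hp V.toLMod W (V.str.braid ((resFunctor φ).obj W))) ∧
        (∀ V W : YD k K,
          (O.δ V W).hom = Functor.OplaxMonoidal.δ (indFunctor φ) V.toLMod W.toLMod) ∧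
        O.η.hom = Functor.OplaxMonoidal.η (indFunctor φ) ∧
        (∀ (V W : LMod k K) (h : H) (v : V) (w : W) {ι : Type u} (r : Coalgebra.Repr k h ι),
          (Functor.OplaxMonoidal.δ (indFunctor φ) V W).lin
              (indMk h (v ⊗ₜ[k] w) : IndCarrier φ (V ⊗ W)) =
            ∑ i ∈ r.index, (indMk (r.left i) v : IndCarrier φ V) ⊗ₜ[k]
              (indMk (r.right i) w : IndCarrier φ W)) ∧
        (∀ (h : H) (x : k),
          (Functor.OplaxMonoidal.η (indFunctor φ)).lin (indMk h x : IndCarrier φ (𝟙_ (LMod k K))) =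
            (Coalgebra.counit (R := k) h * x : k)) ∧
        IsBraidedOplax (ydFunctor (indFunctor φ) δ hδ) O) := by
  refine ⟨fun C _ _ D _ _ L G _ _ adj _ hp => ?_, fun k K H _ _ _ _ _ _ _ φ => ?_⟩
  · exact ⟨fun X => inducedHalfBraiding hp X.2, inducedHalfBraiding_natural hp,
      inducedCenterOplax hp, fun _ _ => rfl, fun _ _ => rfl, rfl,
      isBraidedOplax_inducedCenterFunctor hp⟩
  · refine ⟨projectionFormula_indResAdj φ, indYDStruct φ, colinear_indFunctor_map φ,
      indYDOplax φ, indYDStruct_coact_mk φ, indYDStruct_braid φ, fun _ _ => rfl, rfl,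
      fun V W h v w ι r => ?_, ind_η_lin_mk φ, isBraidedOplax_indYDFunctor φ⟩
    rw [ind_δ_lin_mk, ← r.eq, map_sum]
    rfl
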